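/- Let $V=(V,Y,\mathbf 1,\omega)$ be a vertex operator algebra over $\mathbb C$ of central charge $c$, with $Y(a,z)=\sum_{n\in\mathbb Z}a_nz^{-n-1}$, $L(n)=\omega_{n+1}$ and $V=\bigoplus_n V_n$ the grading by $L(0)$-eigenvalues. Assume that $V$ is strongly rational, that is: - $V$ is of strong CFT type: $V_n=0$ for $n<0$, $V_0=\mathbb C\mathbf 1$ and $L(1)V_1=0$; - $V$ is rational: every admissible ($\mathbb Z_{\ge 0}$-graded) $V$-module is a direct sum of irreducible admissible $V$-modules; - $V$ is $C_2$-cofinite: the span of all $a_{-2}b$ with $a,b\in V$ has finite codimension in $V$. Let $\mathfrak h$ be a Cartan subalgebra of the Lie algebra $V_1$, whose bracket is $[a,b]=a_0b$. Let $M$ be an irreducible (ordinary) $V$-module, with $L(0)$-eigenspace decomposition $M=\bigoplus_{\lambda\in\mathbb C}M_\lambda$, $\dim M_\lambda<\infty$. For $v\in V_1$ let $o(v)=v_0$ act on $M$; it preserves each $M_\lambda$. Put $$\chi_M(v,\tau)=\mathrm{Tr}_M\, e^{2\pi i\,o(v)}q^{L(0)-c/24}=\sum_{\lambda\in\mathbb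 C}\bigl(\mathrm{Tr}_{M_\lambda}e^{2\pi i\, o(v)}\bigr)\,e^{2\pi i\tau(\lambda-c/24)},\qquad q=e^{2\pi i\tau}.$$ Then this series converges absolutely for all $v\in\mathfrak h$ and all $\tau\in\mathbb H=\{\tau\in\mathbb C:\mathrm{Im}\,\tau>0\}$, and its sum $\chi_M(v,\tau)$ is a holomorphic function on $\mathfrak h\times\mathbb H$. -/

import Mathlib

open VertexOperator

noncomputable section

universe u v

/-- The Jacobi identity, written through the coefficients of `z₀^(-l-1) z₁^(-m-1) z₂^(-n-1)`:
`Y` is the vertex operator map of the algebra and `YM` that of the module.  Every sum has only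
finitely many nonzero terms, because vertex operators take values in Laurent series. -/
def JacobiIdentity {V : Type u} {M : Type v} [AddCommGroup V] [Module ℂ V] [AddCommGroup M]
    [Module ℂ M] (Y : V →ₗ[ℂ] VertexOperator ℂ V) (YM : V →ₗ[ℂ] VertexOperator ℂ M) : Prop :=
  ∀ (a b : V) (w : M) (l m n : ℤ),
    ∑ᶠ j : ℕ, Ring.choose m j • ncoeff (YM (ncoeff (Y a) (l + j) b)) (m + n - j) w =
    ∑ᶠ j : ℕ, ((-1) ^ j * Ring.choose l j) •
      (ncoeff (YM a) (m + l - j) (ncoeff (YM b) (n + j) w) -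
        (l.negOnePow : ℤ) • ncoeff (YM b) (l + n - j) (ncoeff (YM a) (m + j) w))

/-- A vertex operator algebra over `ℂ`.  The coefficient `ncoeff (Y a) n` is the mode `aₙ` in
`Y(a, z) = ∑ aₙ z^(-n-1)`, the operator `L(n)` is `ω_{n+1}`, and the homogeneous subspace `V_n`
is the eigenspace of `L(0)` for the eigenvalue `n`. -/
class VertexOperatorAlgebra (V : Type u) [AddCommGroup V] [Module ℂ V] where
  /-- the vertex operators; `aₙ b = 0` for large `n` holds because the values are Laurent series -/
  Y : V →ₗ[ℂ] VertexOperator ℂ V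
  /-- the vacuum vector -/
  vacuum : V
  /-- the conformal (Virasoro) vector -/
  conformal : V
  /-- the central charge, also called the rank -/
  centralCharge : ℂ
  vacuum_mode : ∀ n : ℤ, ncoeff (Y vacuum) n = if n = -1 then 1 else 0
  creation_nonneg : ∀ (a : V) (n : ℤ), 0 ≤ n → ncoeff (Y a) n vacuum = 0
  creation : ∀ a : V, ncoeff (Y a) (-1) vacuum = a
  jacobi : JacobiIdentity Y Y
  virasoro : ∀ m n : ℤ,
    ncoeff (Y conformal) (m + 1) * ncoeff (Y conformal) (n + 1) -
        ncoeff (Y conformal) (n + 1) * ncoeff (Y conformal) (m + 1) =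
      ((m : ℂ) - n) • ncoeff (Y conformal) (m + n + 1) +
        (if m + n = 0 then ((m : ℂ) ^ 3 - m) / 12 * centralCharge else 0) •
          (1 : Module.End ℂ V)
  translation : ∀ (a : V) (n : ℤ),
    ncoeff (Y (ncoeff (Y conformal) 0 a)) n = (-n : ℂ) • ncoeff (Y a) (n - 1)
  graded : DirectSum.IsInternal fun n : ℤ =>
    Module.End.eigenspace (ncoeff (Y conformal) 1) (n : ℂ)
  finite_graded : ∀ n : ℤ,
    Module.Finite ℂ (Module.End.eigenspace (ncoeff (Y conformal) 1) (n : ℂ))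
  bounded_below : ∃ N : ℤ, ∀ n < N,
    Module.End.eigenspace (ncoeff (Y conformal) 1) (n : ℂ) = ⊥
  vacuum_weight : vacuum ∈ Module.End.eigenspace (ncoeff (Y conformal) 1) 0
  conformal_weight : conformal ∈ Module.End.eigenspace (ncoeff (Y conformal) 1) 2

/-- A module for a vertex operator algebra, without any grading (a weak module). -/
class VOAModule (V : Type u) (M : Type v) [AddCommGroup V] [Module ℂ V]
    [VertexOperatorAlgebra V] [AddCommGroup M] [Module ℂ M] where
  YM : V →ₗ[ℂ] VertexOperator ℂ M
  vacuum_mode : ∀ n : ℤ,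
    ncoeff (YM (VertexOperatorAlgebra.vacuum : V)) n = if n = -1 then 1 else 0
  jacobi : JacobiIdentity (VertexOperatorAlgebra.Y : V →ₗ[ℂ] VertexOperator ℂ V) YM

namespace VOA

open VertexOperatorAlgebra

variable {V : Type u} [AddCommGroup V] [Module ℂ V] [VertexOperatorAlgebra V]

variable (V) in
/-- A vertex operator algebra is a module for itself. -/
instance : VOAModule V V where
  YM := Y
  vacuum_mode := vacuum_mode
  jacobi := jacobi

variable (M : Type v) [AddCommGroup M] [Module ℂ M] [VOAModule V M]

/-- The mode `aₙ` acting on the module `M`. -/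
def mode (a : V) (n : ℤ) : Module.End ℂ M := ncoeff (VOAModule.YM (M := M) a) n

variable (V) in
/-- The Virasoro operator `L(n) = ω_{n+1}` on the module `M`. -/
def L (n : ℤ) : Module.End ℂ M := mode M (conformal : V) (n + 1)

variable (V) in
/-- The weight space `M_μ = {w | L(0) w = μ w}`. -/
def weightSpace (μ : ℂ) : Submodule ℂ M := Module.End.eigenspace (L V M 0) μ

variable (V) in
/-- The homogeneous subspace `V_n`. -/
abbrev homogeneous (n : ℤ) : Submodule ℂ V := weightSpace V V (n : ℂ)

/-! ### Commutators and weights -/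

variable {M}

theorem mem_weightSpace {μ : ℂ} {w : M} : w ∈ weightSpace V M μ ↔ L V M 0 w = μ • w :=
  Module.End.mem_eigenspace_iff

theorem jacobi_mode (a b : V) (w : M) (l m n : ℤ) :
    ∑ᶠ j : ℕ, Ring.choose m j • mode M (mode V a (l + j) b) (m + n - j) w =
    ∑ᶠ j : ℕ, ((-1) ^ j * Ring.choose l j) •
      (mode M a (m + l - j) (mode M b (n + j) w) -
        (l.negOnePow : ℤ) • mode M b (l + n - j) (mode M a (m + j) w)) :=
  VOAModule.jacobi (V := V) (M := M) a b w l m n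

theorem mode_vacuum (n : ℤ) :
    mode M (vacuum : V) n = if n = -1 then 1 else 0 :=
  VOAModule.vacuum_mode n

theorem mode_add (a b : V) (n : ℤ) : mode M (a + b) n = mode M a n + mode M b n := by
  simp [mode]

theorem mode_smul (r : ℂ) (a : V) (n : ℤ) : mode M (r • a) n = r • mode M a n := by
  simp [mode]

theorem mode_zero (n : ℤ) : mode M (0 : V) n = 0 := by
  simp [mode]

theorem L_neg_one (a : V) : L V V (-1) a = mode V a (-2) vacuum := by
  have h : mode V (L V V (-1) a) (-1) vacuum = ((-(-1 : ℤ) : ℂ) • mode V a (-1 - 1)) vacuum :=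
    congrArg (fun f : Module.End ℂ V => f vacuum) (translation a (-1))
  have h' : mode V (L V V (-1) a) (-1) vacuum = L V V (-1) a := creation _
  rw [h'] at h
  simpa using h

/-- The translation property on modules. -/
theorem mode_translation (a : V) (n : ℤ) :
    mode M (L V V (-1) a) n = (-n : ℂ) • mode M a (n - 1) := by
  ext w
  have h := jacobi_mode a (vacuum : V) w (-2) 0 n
  rw [finsum_eq_single _ 0 (fun j hj => by
    rw [Ring.choose_zero_pos ℤ (Nat.pos_of_ne_zero hj), zero_smul])] at h
  have hc : ∀ j : ℕ, (-1) ^ j * Ring.choose (-2 : ℤ) j = j + 1 := by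
    intro j
    have h2 : Ring.choose (2 + (j : ℤ) - 1) j = j + 1 := by
      rw [show (2 + (j : ℤ) - 1) = ((j + 1 : ℕ) : ℤ) by push_cast; ring, Ring.choose_natCast,
        Nat.choose_succ_self_right]
      simp
    rw [Ring.choose_neg, h2, Int.negOnePow_def]
    rcases Nat.even_or_odd j with hj | hj <;> simp [hj.neg_one_pow, Units.smul_def, add_comm]
  simp only [hc, mode_vacuum, L_neg_one] at h ⊢
  have hs : ((-2 : ℤ).negOnePow : ℤ) = 1 := by decide
  rw [hs] at h
  simp only [Ring.choose_zero_right, one_smul, Nat.cast_zero, add_zero, zero_add, sub_zero] at h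
  rw [h]
  rcases lt_trichotomy n 0 with hn | hn | hn
  · obtain ⟨k, hk⟩ : ∃ k : ℕ, n = -1 - k := ⟨(-1 - n).toNat, by omega⟩
    rw [finsum_eq_single _ k]
    · rw [if_pos (by omega), if_neg (by omega)]
      subst hk
      simp only [Module.End.one_apply, LinearMap.zero_apply, sub_zero, LinearMap.smul_apply]
      rw [show (-2 - k : ℤ) = -1 - k - 1 by ring, ← Int.cast_smul_eq_zsmul ℂ]
      push_cast
      congr 1
      ring
    · intro j hj
      rw [if_neg (by omega), if_neg (by omega)]
      simp
  · subst hn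
    rw [finsum_eq_zero_of_forall_eq_zero]
    · simp
    · intro j
      rw [if_neg (by omega), if_neg (by omega)]
      simp
  · obtain ⟨k, hk⟩ : ∃ k : ℕ, n = k + 1 := ⟨(n - 1).toNat, by omega⟩
    rw [finsum_eq_single _ k]
    · rw [if_neg (by omega), if_pos (by omega)]
      subst hk
      simp only [Module.End.one_apply, LinearMap.zero_apply, map_zero, zero_sub,
        LinearMap.smul_apply]
      rw [show (k + 1 - 1 : ℤ) = k by ring, ← Int.cast_smul_eq_zsmul ℂ]
      push_cast
      rw [smul_neg, neg_smul]
    · intro j hj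
      rw [if_neg (by omega), if_neg (by omega)]
      simp

/-- The commutator of `L(0)` with a mode. -/
theorem L_zero_mode (a : V) (n : ℤ) (w : M) :
    L V M 0 (mode M a n w) =
      mode M a n (L V M 0 w) + mode M (L V V 0 a) n w - (n + 1 : ℂ) • mode M a n w := by
  have h := jacobi_mode (conformal : V) a w 0 1 n
  rw [finsum_eq_single (fun j : ℕ => ((-1) ^ j * Ring.choose (0 : ℤ) j) • _) 0 (fun j hj => by
    rw [Ring.choose_zero_pos ℤ (Nat.pos_of_ne_zero hj), mul_zero, zero_smul])] at h
  rw [finsum_eq_sum_of_support_subset (s := Finset.range 2)] at h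
  · simp only [Finset.sum_range_succ, Finset.sum_range_zero] at h
    have h1 : mode M (mode V (conformal : V) 0 a) (1 + n) w = -(n + 1 : ℂ) • mode M a n w := by
      have := congrArg (fun f : Module.End ℂ M => f w) (mode_translation (M := M) a (1 + n))
      simp only [L, LinearMap.smul_apply] at this
      rw [show (1 + n - 1 : ℤ) = n by ring, show (-1 + 1 : ℤ) = 0 by ring] at this
      rw [this]
      push_cast
      congr 1
      ring
    simp [h1] at h
    simp only [L, zero_add]
    rw [sub_eq_iff_eq_add'.mp h.symm]
    module
  · intro j hj
    simp only [Finset.coe_range, Set.mem_Iio]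
    by_contra hlt
    apply hj
    have : Ring.choose (1 : ℤ) j = 0 := by
      have := Ring.choose_natCast (R := ℤ) 1 j
      rw [Nat.choose_eq_zero_of_lt (by omega)] at this
      simpa using this
    simp [this]

/-- `aₙ M_μ ⊆ M_{μ + wt a - n - 1}` for homogeneous `a`. -/
theorem mode_mem_weightSpace {a : V} {k μ : ℂ} {w : M} (ha : a ∈ weightSpace V V k)
    (hw : w ∈ weightSpace V M μ) (n : ℤ) :
    mode M a n w ∈ weightSpace V M (μ + k - n - 1) := by
  rw [mem_weightSpace] at *
  rw [L_zero_mode, ha, hw, mode_smul, map_smul, LinearMap.smul_apply]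
  module

/-! ### Vertex operator algebras of CFT type and the Lie algebra of weight one -/

variable (V) in
/-- CFT type: `V = ⨁_{n ≥ 0} V_n` and `V_0 = ℂ 𝟏`. -/
class IsCFTType : Prop where
  homogeneous_neg : ∀ n : ℤ, n < 0 → homogeneous V n = ⊥
  homogeneous_zero : homogeneous V 0 = Submodule.span ℂ {vacuum}

variable (V) in
/-- Strong CFT type: CFT type and `L(1) V_1 = 0`. -/
class IsStrongCFTType : Prop extends IsCFTType V where
  L_one : ∀ a ∈ homogeneous V 1, L V V 1 a = 0

theorem zero_mode_mem {a b : V} (ha : a ∈ homogeneous V 1) (hb : b ∈ homogeneous V 1) :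
    mode V a 0 b ∈ homogeneous V 1 := by
  have h := mode_mem_weightSpace ha hb 0
  have e : (((1 : ℤ) : ℂ) + ((1 : ℤ) : ℂ) - ((0 : ℤ) : ℂ) - 1) = ((1 : ℤ) : ℂ) := by simp
  rwa [e] at h

theorem zero_mode_skew [IsCFTType V] {a b : V} (ha : a ∈ homogeneous V 1)
    (hb : b ∈ homogeneous V 1) : mode V a 0 b = -mode V b 0 a := by
  have h := jacobi_mode a b (vacuum : V) 0 (-1) 0
  rw [finsum_eq_single (fun j : ℕ => ((-1) ^ j * Ring.choose (0 : ℤ) j) • _) 0 (fun j hj => by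
    rw [Ring.choose_zero_pos ℤ (Nat.pos_of_ne_zero hj), mul_zero, zero_smul])] at h
  rw [finsum_eq_single _ 0] at h
  · have c1 : mode V (mode V a 0 b) (-1) vacuum = mode V a 0 b := creation _
    have c2 : mode V b 0 vacuum = 0 := creation_nonneg _ _ le_rfl
    have c3 : mode V a (-1) vacuum = a := creation _
    simpa [c1, c2, c3] using h
  · intro j hj
    obtain ⟨k, rfl⟩ := Nat.exists_eq_succ_of_ne_zero hj
    have hm := mode_mem_weightSpace ha hb (k + 1 : ℕ)
    have e : (((1 : ℤ) : ℂ) + ((1 : ℤ) : ℂ) - (((k + 1 : ℕ) : ℤ) : ℂ) - 1) =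
        ((-k : ℤ) : ℂ) := by push_cast; ring
    rw [e] at hm
    have hz : mode V (mode V a (k + 1 : ℕ) b) (-1 + 0 - (k + 1 : ℕ)) (vacuum : V) = 0 := by
      rcases Nat.eq_zero_or_pos k with rfl | hk
      · change _ ∈ homogeneous V (-((0 : ℕ) : ℤ)) at hm
        rw [Nat.cast_zero, neg_zero, IsCFTType.homogeneous_zero,
          Submodule.mem_span_singleton] at hm
        obtain ⟨r, hr⟩ := hm
        rw [← hr, mode_smul, mode_vacuum, if_neg (by omega)]
        simp
      · change _ ∈ homogeneous V (-(k : ℤ)) at hm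
        rw [IsCFTType.homogeneous_neg _ (by omega), Submodule.mem_bot] at hm
        rw [hm, mode_zero, LinearMap.zero_apply]
    rw [zero_add]
    simp only [Nat.succ_eq_add_one]
    rw [hz, smul_zero]

theorem zero_mode_comm (a b : V) (w : M) :
    mode M (mode V a 0 b) 0 w = mode M a 0 (mode M b 0 w) - mode M b 0 (mode M a 0 w) := by
  have h := jacobi_mode a b w 0 0 0
  rw [finsum_eq_single _ 0 (fun j hj => by rw [Ring.choose_zero_pos ℤ (Nat.pos_of_ne_zero hj), zero_smul]),
    finsum_eq_single _ 0 (fun j hj => by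
      rw [Ring.choose_zero_pos ℤ (Nat.pos_of_ne_zero hj), mul_zero, zero_smul])] at h
  simpa using h

variable (V) in
/-- The weight one subspace `V_1`, a Lie algebra under `[a, b] = a₀ b`. -/
abbrev WeightOne : Type u := homogeneous V 1

instance [IsCFTType V] : LieRing (WeightOne V) where
  bracket a b := ⟨mode V (a : V) 0 (b : V), zero_mode_mem a.2 b.2⟩
  add_lie a b c := Subtype.ext (by simp [mode_add])
  lie_add a b c := Subtype.ext (by simp)
  lie_self a := Subtype.ext (by
    have h := zero_mode_skew a.2 a.2
    have : IsAddTorsionFree V := IsAddTorsionFree.of_isTorsionFree ℂ V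
    exact self_eq_neg.mp h)
  leibniz_lie a b c := Subtype.ext (by
    change mode V (a : V) 0 (mode V (b : V) 0 (c : V)) =
      mode V (mode V (a : V) 0 (b : V)) 0 (c : V) + mode V (b : V) 0 (mode V (a : V) 0 (c : V))
    rw [zero_mode_comm]
    abel)

instance [IsCFTType V] : LieAlgebra ℂ (WeightOne V) where
  lie_smul r a b := Subtype.ext (by
    change mode V (a : V) 0 (r • (b : V)) = r • mode V (a : V) 0 (b : V)
    rw [map_smul])

/-! ### Rationality -/

variable (V) (M)

variable {M} in
/-- `N` is a `V`-submodule: a subspace stable under all modes. -/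
def IsVSubmodule (N : Submodule ℂ M) : Prop :=
  ∀ (a : V) (n : ℤ), ∀ w ∈ N, mode M a n w ∈ N

/-- A grading `M = ⨁_{n ≥ 0} M(n)` that makes `M` an admissible module. -/
structure AdmissibleGrading where
  gr : ℤ → Submodule ℂ M
  internal : DirectSum.IsInternal gr
  gr_neg : ∀ n < 0, gr n = ⊥
  gr_zero : gr 0 ≠ ⊥
  mode_mem : ∀ (k : ℤ), ∀ a ∈ homogeneous V k, ∀ (m n : ℤ), ∀ w ∈ gr n,
    mode M a m w ∈ gr (k - m - 1 + n)

variable {V M} in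
/-- `N` is a graded submodule of the admissible module `M`, that is `N = ⨁ (N ∩ M(n))`.  After a
shift of the degrees a nonzero one is itself an admissible module. -/
def AdmissibleGrading.IsGradedSubmodule (g : AdmissibleGrading V M) (N : Submodule ℂ M) : Prop :=
  IsVSubmodule V N ∧ N = ⨆ n, N ⊓ g.gr n

variable {V M} in
/-- `N` is an irreducible admissible submodule of `M`. -/
def AdmissibleGrading.IsIrreducible (g : AdmissibleGrading V M) (N : Submodule ℂ M) : Prop :=
  g.IsGradedSubmodule N ∧ N ≠ ⊥ ∧ ∀ N' ≤ N, g.IsGradedSubmodule N' → N' = ⊥ ∨ N' = N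

/-- `V` is rational: every admissible module is a direct sum of irreducible admissible modules. -/
def IsRational (V : Type u) [AddCommGroup V] [Module ℂ V] [VertexOperatorAlgebra V] : Prop :=
  ∀ (W : Type u) [AddCommGroup W] [Module ℂ W] [VOAModule V W] (g : AdmissibleGrading V W),
    ∃ (ι : Type u) (N : ι → Submodule ℂ W),
      (∀ i, g.IsIrreducible (N i)) ∧ iSupIndep N ∧ ⨆ i, N i = ⊤

/-- `C_2(V)`, the span of all `a_{-2} b`. -/
def C₂ : Submodule ℂ V := Submodule.span ℂ {x | ∃ a b : V, x = mode V a (-2) b}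

/-- Strongly rational: of strong CFT type, rational and `C_2`-cofinite. -/
class IsStronglyRational : Prop extends IsStrongCFTType V where
  rational : IsRational V
  C₂_cofinite : Module.Finite ℂ (V ⧸ C₂ V)

/-! ### Ordinary modules and their characters -/

/-- An (ordinary) `V`-module: an admissible module that is the direct sum of its finite-dimensional
`L(0)`-eigenspaces `M_μ`, with `M_{μ+n} = 0` for every `μ` and all sufficiently small integers
`n`. -/
class IsOrdinaryModule : Prop where
  admissible : Nonempty (AdmissibleGrading V M)
  internal : DirectSum.IsInternal (weightSpace V M)
  finite_weightSpace : ∀ μ : ℂ, Module.Finite ℂ (weightSpace V M μ)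
  bounded_below : ∀ μ : ℂ, ∃ N : ℤ, ∀ n < N, weightSpace V M (μ + n) = ⊥

/-- `M` is irreducible: it is nonzero and has no submodules but `0` and `M`. -/
def IsIrreducibleModule : Prop :=
  Nontrivial M ∧ ∀ N : Submodule ℂ M, IsVSubmodule V N → N = ⊥ ∨ N = ⊤

instance [IsOrdinaryModule V M] (μ : ℂ) : Module.Finite ℂ (weightSpace V M μ) :=
  IsOrdinaryModule.finite_weightSpace μ

variable {V}

/-- `o(a) = a₀` for `a ∈ V_1`, as an operator on the weight space `M_μ`. -/
def zeroMode (a : WeightOne V) (μ : ℂ) : Module.End ℂ (weightSpace V M μ) :=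
  (mode M (a : V) 0).restrict fun w hw => by
    have h := mode_mem_weightSpace (M := M) a.2 hw 0
    have e : (μ + ((1 : ℤ) : ℂ) - ((0 : ℤ) : ℂ) - 1) = μ := by simp
    rwa [e] at h

/-- The exponential of an endomorphism of a finite-dimensional complex vector space, computed as a
matrix exponential. -/
def expEnd {E : Type v} [AddCommGroup E] [Module ℂ E] [Module.Finite ℂ E]
    (A : Module.End ℂ E) : Module.End ℂ E :=
  Matrix.toLin (Module.finBasis ℂ E) (Module.finBasis ℂ E)
    (NormedSpace.exp (LinearMap.toMatrix (Module.finBasis ℂ E) (Module.finBasis ℂ E) A))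

/-- The contribution of `M_μ` to `Tr_M e^{2πi o(a)} q^{L(0) - c/24}` with `q = e^{2πiτ}`. -/
def characterTerm [IsOrdinaryModule V M] (a : WeightOne V) (τ μ : ℂ) : ℂ :=
  LinearMap.trace ℂ (weightSpace V M μ)
      (expEnd ((2 * Real.pi * Complex.I : ℂ) • zeroMode M a μ)) *
    Complex.exp (2 * Real.pi * Complex.I * τ * (μ - centralCharge V / 24))

/-- The character `χ_M(a, τ) = Tr_M e^{2πi o(a)} q^{L(0) - c/24}`. -/
def character [IsOrdinaryModule V M] (a : WeightOne V) (τ : ℂ) : ℂ :=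
  ∑' μ : ℂ, characterTerm M a τ μ

end VOA

/-- `f` is holomorphic on `E × ℍ`, where `E` is a finite-dimensional complex vector space: it is
complex differentiable there in the coordinates of any basis of `E`. -/
def HolomorphicOnProdUpperHalfPlane {E : Type u} [AddCommGroup E] [Module ℂ E]
    (f : E → ℂ → ℂ) : Prop :=
  Module.Finite ℂ E ∧ ∀ (r : ℕ) (b : Module.Basis (Fin r) ℂ E),
    DifferentiableOn ℂ (fun p : (Fin r → ℂ) × ℂ => f (∑ i, p.1 i • b i) p.2) {p | 0 < p.2.im}

end

/-! Let `μ` be the lowest weight of the irreducible module `M`.  By irreducibility `M` is spanned by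
products of modes applied to `M_μ`.  Modes commute up to products of smaller weight; by
`C₂`-cofiniteness modes of vectors of large weight reduce to such products; and two modes of the
same degree are, up to such products, a single mode of a normally ordered product and pairs of modes
of different degrees.  So `M` is spanned by products of modes of finitely many vectors with strictly
decreasing degrees, as in Gaberdiel–Neitzke and Buhl, and `dim M_{μ+n}` is bounded by a number of
coloured strict partitions of `n`, which grows subexponentially.

Such a product has `O(√n)` factors on `M_{μ+n}`, and the zero mode of `a ∈ V₁` acts on it as a
derivation that preserves the weights of the vectors.  In dual terms the norm of `o(a)` on `M_{μ+n}`
is thus `O(‖a‖ √n)`, so the traces of `e^{2πi o(a)}` are subexponential in `n`, locally uniformly in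
`a`.  The character is therefore a locally uniformly convergent series of holomorphic functions. -/

noncomputable section

universe u v

theorem finsum_int_eq_finsum_nat {E : Type*} [AddCommMonoid E] {f : ℤ → E}
    (hf : f.HasFiniteSupport) (k : ℤ) :
    ∑ᶠ p, f p = ∑ᶠ j : ℕ, (f (k + j) + f (k - 1 - j)) := by
  have hup : Function.Injective fun j : ℕ => k + (j : ℤ) := fun i j h => by simpa using h
  have hdown : Function.Injective fun j : ℕ => k - 1 - (j : ℤ) := fun i j h => by simpa using h
  have hdisj : Disjoint (Set.range fun j : ℕ => k + (j : ℤ))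
      (Set.range fun j : ℕ => k - 1 - (j : ℤ)) := by
    rw [Set.disjoint_left]
    rintro _ ⟨i, rfl⟩ ⟨j, hj⟩
    dsimp only at hj
    omega
  have hcover : (Set.range fun j : ℕ => k + (j : ℤ)) ∪
      (Set.range fun j : ℕ => k - 1 - (j : ℤ)) = Set.univ := by
    refine Set.eq_univ_of_forall fun p => ?_
    rcases le_or_gt k p with hp | hp
    · exact Or.inl ⟨(p - k).toNat, by dsimp only; omega⟩
    · exact Or.inr ⟨(k - 1 - p).toNat, by dsimp only; omega⟩
  rw [finsum_add_distrib (hf.preimage hup.injOn) (hf.preimage hdown.injOn),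
    ← finsum_mem_range hup, ← finsum_mem_range hdown,
    ← finsum_mem_union' hdisj (hf.inter_of_right _) (hf.inter_of_right _), hcover,
    finsum_mem_univ]

section Submodules

variable {R E : Type*} [Ring R] [AddCommGroup E] [Module R E] {Z : Submodule R E}

theorem mem_iff_mem_of_sub_mem {x y : E} (h : x - y ∈ Z) : x ∈ Z ↔ y ∈ Z :=
  ⟨fun hx => (Z.sub_mem_iff_right hx).mp h, fun hy => (Z.sub_mem_iff_left hy).mp h⟩

theorem finsum_mem_of_forall_mem {ι : Sort*} {f : ι → E} (h : ∀ i, f i ∈ Z) : ∑ᶠ i, f i ∈ Z :=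
  finsum_induction (· ∈ Z) Z.zero_mem (fun _ _ => Z.add_mem) h

theorem mem_of_finsum_mem {ι : Type*} {f : ι → E} (hf : f.HasFiniteSupport)
    (hsum : ∑ᶠ i, f i ∈ Z) (i : ι) (h : ∀ j ≠ i, f j ∈ Z) : f i ∈ Z := by
  rw [← add_finsum_cond_ne i hf] at hsum
  exact (Z.add_mem_iff_left
    (finsum_mem_of_forall_mem fun j => finsum_mem_of_forall_mem (h j))).mp hsum

theorem exists_finset_forall_notMem_eq {ι : Type*} {A B : ι → Submodule R E} {C : Submodule R E}
    [Module.Finite R (E ⧸ C)] (hA : iSupIndep A) (htop : ⨆ i, A i = ⊤) (hBA : B ≤ A)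
    (hC : C ≤ ⨆ i, B i) : ∃ t : Finset ι, ∀ i ∉ t, B i = A i := by
  classical
  have hcompact : IsCompactElement (⊤ : Submodule R (E ⧸ C)) :=
    (Submodule.fg_iff_compact _).mp Module.Finite.fg_top
  have hcover : (⊤ : Submodule R (E ⧸ C)) ≤ ⨆ i, (A i).map C.mkQ := by
    rw [← Submodule.map_iSup, htop, Submodule.map_top, Submodule.range_mkQ]
  obtain ⟨t, ht⟩ :=
    CompleteLattice.IsCompactElement.exists_finset_of_le_iSup _ hcompact _ hcover
  let D : ι → Submodule R E := fun i => if i ∈ t then A i else B i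
  have hBD : B ≤ D := fun i => by
    by_cases hi : i ∈ t
    · simpa only [D, if_pos hi] using hBA i
    · simp only [D, if_neg hi, le_rfl]
  have hDA : D ≤ A := fun i => by
    by_cases hi : i ∈ t
    · simp only [D, if_pos hi, le_rfl]
    · simpa only [D, if_neg hi] using hBA i
  have hDtop : ⨆ i, D i = ⊤ := by
    have hmap : (⊤ : Submodule R (E ⧸ C)) ≤ (⨆ i, D i).map C.mkQ := by
      refine ht.trans (iSup₂_le fun i hi => Submodule.map_mono ?_)
      exact (if_pos hi : D i = A i) ▸ le_iSup D i
    rw [← sup_eq_right.mpr (hC.trans (iSup_mono hBD)), ← Submodule.comap_map_mkQ,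
      top_le_iff.mp hmap, Submodule.comap_top]
  exact ⟨t, fun i hi => (if_neg hi : D i = B i) ▸
    congrFun ((hA.le_iff_eq_of_iSup_eq_top hDtop).mp hDA) i⟩

end Submodules

theorem exists_perm_append_pair_of_not_nodup_map {α β : Type*} {f : α → β} {l : List α}
    (h : ¬ (l.map f).Nodup) : ∃ l' x y, l.Perm (l' ++ [x, y]) ∧ f x = f y := by
  induction l with
  | nil => simp at h
  | cons z l ih =>
    rw [List.map_cons, List.nodup_cons, not_and_or, not_not] at h
    rcases h with h | h
    · obtain ⟨y, hy, hyz⟩ := List.mem_map.mp h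
      obtain ⟨s, t, rfl⟩ := List.append_of_mem hy
      exact ⟨s ++ t, z, y, (List.perm_middle.cons z).trans
        (List.perm_append_comm (l₁ := [z, y]) (l₂ := s ++ t)), hyz.symm⟩
    · obtain ⟨l', x, y, hp, hd⟩ := ih h
      exact ⟨z :: l', x, y, hp.cons z, hd⟩

theorem exists_perm_append_singleton_of_mem {α : Type*} {x : α} {l : List α} (h : x ∈ l) :
    ∃ l', l.Perm (l' ++ [x]) := by
  obtain ⟨s, t, rfl⟩ := List.append_of_mem h
  exact ⟨s ++ t, List.perm_middle.trans (List.perm_append_singleton x (s ++ t)).symm⟩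

/-! ### Strict partitions with coloured parts -/

/-- A strict partition of `n` whose parts carry colours in `ι`, written as the decreasing list of
its parts; zero is allowed as a part. -/
abbrev ColoredStrictPartition (ι : Type*) (n : ℕ) : Type _ :=
  {l : List (ι × ℕ) // (l.map Prod.snd).Pairwise (· > ·) ∧ (l.map Prod.snd).sum = n}

namespace ColoredStrictPartition

theorem length_le_of_pairwise_gt {a : ℕ} {l : List ℕ} (h : (a :: l).Pairwise (· > ·)) :
    l.length ≤ a := by
  have hsub : l ⊆ List.range a := fun b hb => List.mem_range.mpr (List.rel_of_pairwise_cons h hb)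
  simpa using (h.of_cons.nodup.subperm hsub).length_le

theorem length_mul_length_sub_one_le {l : List ℕ} (h : l.Pairwise (· > ·)) :
    (l.length : ℝ) * (l.length - 1) ≤ 2 * (l.sum : ℕ) := by
  induction l with
  | nil => simp
  | cons a l ih =>
    have ha : (l.length : ℝ) ≤ a := by exact_mod_cast length_le_of_pairwise_gt h
    have := ih h.of_cons
    rw [List.length_cons, List.sum_cons, Nat.cast_succ, Nat.cast_add]
    linarith

variable {ι : Type*} {n : ℕ}

theorem length_le (l : ColoredStrictPartition ι n) : (l.1.length : ℝ) ≤ √(2 * n) + 1 := by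
  have h := length_mul_length_sub_one_le l.2.1
  rw [l.2.2, List.length_map] at h
  rcases le_total (l.1.length : ℝ) 1 with h1 | h1
  · linarith [Real.sqrt_nonneg (2 * n)]
  · linarith [Real.le_sqrt_of_sq_le (show ((l.1.length : ℝ) - 1) ^ 2 ≤ 2 * n by nlinarith)]

theorem snd_le (l : ColoredStrictPartition ι n) {p : ι × ℕ} (hp : p ∈ l.1) : p.2 ≤ n :=
  (List.le_sum_of_mem (List.mem_map_of_mem hp)).trans l.2.2.le

open Classical in
/-- The set of coloured parts; since the parts are distinct, it determines the partition. -/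
def toFinset (l : ColoredStrictPartition ι n) : Finset (ι × ℕ) := l.1.toFinset

theorem toFinset_injective :
    Function.Injective (toFinset : ColoredStrictPartition ι n → Finset (ι × ℕ)) := by
  classical
  intro l l' h
  let r (p q : ι × ℕ) : Prop := p.2 > q.2
  have : Std.Irrefl r := ⟨fun p => lt_irrefl p.2⟩
  have : Std.Antisymm r := ⟨fun p q hpq hqp => absurd hpq (lt_asymm hqp)⟩
  refine Subtype.ext ((List.pairwise_map.mp l.2.1 : l.1.Pairwise r).eq_of_mem_iff
    (List.pairwise_map.mp l'.2.1) fun p => ?_)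
  simpa [toFinset] using Finset.ext_iff.mp h p

theorem sum_toFinset (l : ColoredStrictPartition ι n) : ∑ p ∈ l.toFinset, p.2 = n := by
  classical
  rw [toFinset, List.sum_toFinset _ l.2.1.nodup.of_map, l.2.2]

theorem toFinset_mem_powerset [Fintype ι] (l : ColoredStrictPartition ι n) :
    l.toFinset ∈ (Finset.univ ×ˢ Finset.range (n + 1) : Finset (ι × ℕ)).powerset := by
  classical
  refine Finset.mem_powerset.mpr fun p hp => Finset.mem_product.mpr ⟨Finset.mem_univ _, ?_⟩
  exact Finset.mem_range_succ_iff.mpr (l.snd_le (by simpa [toFinset] using hp))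

instance [Finite ι] : Finite (ColoredStrictPartition ι n) := by
  have := Fintype.ofFinite ι
  exact Finite.of_injective (fun l => (⟨l.toFinset, l.toFinset_mem_powerset⟩ : Finset.powerset _))
    fun _ _ h => toFinset_injective (Subtype.ext_iff.mp h)

variable (ι n) in
/-- Compare with the generating function `∏ₖ (1 + qᵏ) ^ |ι|`. -/
theorem card_mul_pow_le [Fintype ι] {q : ℝ} (hq0 : 0 ≤ q) (hq1 : q < 1) :
    Nat.card (ColoredStrictPartition ι n) * q ^ n ≤ Real.exp (Fintype.card ι * (1 - q)⁻¹) := by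
  have := Fintype.ofFinite (ColoredStrictPartition ι n)
  set U : Finset (ι × ℕ) := Finset.univ ×ˢ Finset.range (n + 1)
  have hgeom : ∑ k ∈ Finset.range (n + 1), q ^ k ≤ (1 - q)⁻¹ := by
    rw [← tsum_geometric_of_lt_one hq0 hq1]
    exact (summable_geometric_of_lt_one hq0 hq1).sum_le_tsum _ fun k _ => pow_nonneg hq0 k
  calc Nat.card (ColoredStrictPartition ι n) * q ^ n
      = ∑ l : ColoredStrictPartition ι n, ∏ p ∈ l.toFinset, q ^ p.2 := by
        simp only [Finset.prod_pow_eq_pow_sum, sum_toFinset, Finset.sum_const, Finset.card_univ,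
          nsmul_eq_mul, Nat.card_eq_fintype_card]
    _ = ∑ s ∈ Finset.univ.map ⟨_, toFinset_injective (ι := ι) (n := n)⟩, ∏ p ∈ s, q ^ p.2 := by
        rw [Finset.sum_map, Function.Embedding.coeFn_mk]
    _ ≤ ∑ s ∈ U.powerset, ∏ p ∈ s, q ^ p.2 := by
        refine Finset.sum_le_sum_of_subset_of_nonneg ?_ fun s _ _ => by positivity
        exact Finset.map_subset_iff_subset_preimage.mpr fun l _ =>
          Finset.mem_preimage.mpr l.toFinset_mem_powerset
    _ = ∏ p ∈ U, (q ^ p.2 + 1) := (Finset.prod_add_one U).symm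
    _ ≤ ∏ p ∈ U, Real.exp (q ^ p.2) :=
        Finset.prod_le_prod (fun p _ => by positivity) fun p _ => Real.add_one_le_exp _
    _ = Real.exp (Fintype.card ι * ∑ k ∈ Finset.range (n + 1), q ^ k) := by
        simp only [← Real.exp_sum, U, Finset.sum_product, Finset.sum_const, Finset.card_univ,
          nsmul_eq_mul]
    _ ≤ Real.exp (Fintype.card ι * (1 - q)⁻¹) := by gcongr

end ColoredStrictPartition

/-- `u` grows more slowly than every exponential `exp (δ n)` with `δ > 0`. -/
def IsSubexponential (u : ℕ → ℝ) : Prop :=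
  ∀ δ > 0, u =O[Filter.atTop] fun n => Real.exp (δ * n)

namespace IsSubexponential

theorem of_le {u : ℕ → ℝ} (hu : ∀ n, 0 ≤ u n)
    (h : ∀ δ > 0, ∃ A, ∀ n, u n ≤ A * Real.exp (δ * n)) : IsSubexponential u := fun δ hδ => by
  obtain ⟨A, hA⟩ := h δ hδ
  refine Asymptotics.IsBigO.of_bound A (.of_forall fun n => ?_)
  rw [Real.norm_of_nonneg (hu n), Real.norm_of_nonneg (Real.exp_pos _).le]
  exact hA n

theorem mul {u v : ℕ → ℝ} (hu : IsSubexponential u) (hv : IsSubexponential v) :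
    IsSubexponential fun n => u n * v n := fun δ hδ => by
  refine ((hu _ (half_pos hδ)).mul (hv _ (half_pos hδ))).congr_right fun n => ?_
  rw [← Real.exp_add]
  ring_nf

theorem const {a : ℝ} (ha : 0 ≤ a) : IsSubexponential fun _ => a :=
  of_le (fun _ => ha) fun δ hδ => ⟨a, fun n =>
    le_mul_of_one_le_right ha (Real.one_le_exp (by positivity))⟩

theorem exp_mul_sqrt_add (a b : ℝ) :
    IsSubexponential fun n : ℕ => Real.exp (a * (√(2 * n) + b)) :=
  of_le (fun _ => (Real.exp_pos _).le) fun δ hδ => by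
    refine ⟨Real.exp (a ^ 2 / (2 * δ) + a * b), fun n => ?_⟩
    rw [← Real.exp_add, Real.exp_le_exp]
    have hsqrt : √(2 * n) ^ 2 = 2 * n := Real.sq_sqrt (by positivity)
    -- AM-GM: `a s ≤ a² / (2δ) + δ s² / 2` for `s = √(2n)`
    have hamgm : 0 ≤ (a - δ * √(2 * n)) ^ 2 / (2 * δ) := by positivity
    have hexpand : (a - δ * √(2 * n)) ^ 2 / (2 * δ) =
        a ^ 2 / (2 * δ) - a * √(2 * n) + δ * √(2 * n) ^ 2 / 2 := by
      field_simp
      ring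
    rw [hexpand, hsqrt] at hamgm
    linarith

theorem card_coloredStrictPartition (ι : Type*) [Finite ι] :
    IsSubexponential fun n => Nat.card (ColoredStrictPartition ι n) :=
  of_le (fun _ => Nat.cast_nonneg _) fun δ hδ => by
    have := Fintype.ofFinite ι
    refine ⟨Real.exp (Fintype.card ι * (1 - Real.exp (-δ))⁻¹), fun n => ?_⟩
    have h := ColoredStrictPartition.card_mul_pow_le ι n (Real.exp_pos (-δ)).le
      (Real.exp_lt_one_iff.mpr (neg_lt_zero.mpr hδ))
    rwa [← Real.exp_nat_mul, mul_neg, mul_comm (n : ℝ), Real.exp_neg, ← div_eq_mul_inv,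
      div_le_iff₀ (Real.exp_pos _)] at h

theorem summable_mul_exp {u : ℕ → ℝ} (hu : IsSubexponential u) {δ : ℝ} (hδ : 0 < δ) :
    Summable fun n : ℕ => u n * Real.exp (-δ * n) := by
  refine summable_of_isBigO_nat
    (Real.summable_exp_nat_mul_iff.mpr (neg_lt_zero.mpr (half_pos hδ))) ?_
  refine ((hu _ (half_pos hδ)).mul (Asymptotics.isBigO_refl _ _)).congr_right fun n => ?_
  rw [← Real.exp_add]
  ring_nf

end IsSubexponential

/-! ### Traces of exponentials -/

/-- The operator `f` has norm at most `R` with respect to the dual of the seminorm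
`φ ↦ supᵢ ‖φ (x i)‖` on functionals.  All eigenvalues of `f` are then bounded by `R` as soon as the
family `x` spans. -/
def DualBound {E : Type*} [AddCommGroup E] [Module ℂ E] {ι : Type*} (x : ι → E)
    (f : Module.End ℂ E) (R : ℝ) : Prop :=
  ∀ (φ : Module.Dual ℂ E) (B : ℝ), (∀ i, ‖φ (x i)‖ ≤ B) → ∀ i, ‖φ (f (x i))‖ ≤ R * B

namespace DualBound

variable {E : Type*} [AddCommGroup E] [Module ℂ E] {ι : Type*} {x : ι → E} {f : Module.End ℂ E}
  {R : ℝ}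

theorem pow (h : DualBound x f R) (k : ℕ) : DualBound x (f ^ k) (R ^ k) := by
  induction k with
  | zero => intro φ B hB i; simpa using hB i
  | succ k ih =>
    intro φ B hB i
    rw [pow_succ, pow_succ', mul_assoc]
    exact h (φ ∘ₗ f ^ k) (R ^ k * B) (ih φ B hB) i

theorem smul (h : DualBound x f R) (c : ℂ) : DualBound x (c • f) (‖c‖ * R) := by
  intro φ B hB i
  rw [LinearMap.smul_apply, map_smul, norm_smul, mul_assoc]
  exact mul_le_mul_of_nonneg_left (h φ B hB i) (norm_nonneg c)

theorem mono {S : ℝ} (h : DualBound x f R) (hRS : R ≤ S) : DualBound x f S := fun φ B hB i =>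
  (h φ B hB i).trans (mul_le_mul_of_nonneg_right hRS ((norm_nonneg _).trans (hB i)))

theorem exists_forall_linearMap {F : Type*} [NormedAddCommGroup F] [NormedSpace ℂ F]
    [FiniteDimensional ℂ F] [Finite ι] (b : Module.Basis ι ℂ E) (A : F →ₗ[ℂ] Module.End ℂ E) :
    ∃ C : ℝ, 0 ≤ C ∧ ∀ v, DualBound b (A v) (C * ‖v‖) := by
  have := Fintype.ofFinite ι
  let entry (i j : ι) : F →L[ℂ] ℂ := (b.coord j ∘ₗ A.flip (b i)).toContinuousLinearMap
  refine ⟨∑ i, ∑ j, ‖entry i j‖, by positivity, fun v φ B hB i => ?_⟩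
  have hB0 : 0 ≤ B := (norm_nonneg _).trans (hB i)
  have hexpand : φ (A v (b i)) = ∑ j, entry i j v * φ (b j) := by
    conv_lhs => rw [← b.sum_repr (A v (b i)), map_sum]
    simp only [map_smul, smul_eq_mul]
    rfl
  calc ‖φ (A v (b i))‖ ≤ ∑ j, ‖entry i j‖ * ‖v‖ * B := by
        rw [hexpand]
        refine norm_sum_le_of_le _ fun j _ => ?_
        rw [norm_mul]
        exact mul_le_mul ((entry i j).le_opNorm v) (hB j) (norm_nonneg _) (by positivity)
    _ = (∑ j, ‖entry i j‖) * ‖v‖ * B := by simp only [Finset.sum_mul]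
    _ ≤ (∑ i, ∑ j, ‖entry i j‖) * ‖v‖ * B := by
        have := Finset.single_le_sum (f := fun i => ∑ j, ‖entry i j‖)
          (fun i _ => by positivity) (Finset.mem_univ i)
        gcongr

variable [Module.Finite ℂ E] [Finite ι]

theorem norm_eigenvalue_le (h : DualBound x f R) (hx : Submodule.span ℂ (Set.range x) = ⊤)
    {α : ℂ} (hα : f.HasEigenvalue α) : ‖α‖ ≤ R := by
  have hrange : LinearMap.range (f - algebraMap ℂ _ α) ≠ ⊤ := fun htop =>
    hα (Module.End.eigenspace_def.trans (LinearMap.ker_eq_bot_iff_range_eq_top.mpr htop))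
  obtain ⟨φ, hφ0, hφ⟩ := Submodule.exists_le_ker_of_lt_top _ hrange.lt_top
  have hφf (e : E) : φ (f e) = α * φ e := by
    simpa [Module.algebraMap_end_apply, sub_eq_zero] using hφ (LinearMap.mem_range_self _ e)
  obtain ⟨i₁, hi₁⟩ : ∃ i, φ (x i) ≠ 0 := by
    by_contra! hz
    exact hφ0 (LinearMap.ext_on_range hx hz)
  have : Nonempty ι := ⟨i₁⟩
  obtain ⟨i₀, hi₀⟩ := Finite.exists_max fun i => ‖φ (x i)‖
  have hmax := h φ _ hi₀ i₀
  rw [hφf, norm_mul] at hmax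
  exact le_of_mul_le_mul_right hmax ((norm_pos_iff.mpr hi₁).trans_le (hi₀ i₁))

theorem norm_trace_le (h : DualBound x f R) (hx : Submodule.span ℂ (Set.range x) = ⊤)
    (hR : 0 ≤ R) : ‖LinearMap.trace ℂ E f‖ ≤ Module.finrank ℂ E * R := by
  rw [Module.End.trace_eq_sum_roots_charpoly_of_splits (IsAlgClosed.splits f.charpoly)]
  have hroots : ∀ r ∈ f.charpoly.roots.map (‖·‖), r ≤ R := by
    refine Multiset.forall_mem_map_iff.mpr fun α hα => h.norm_eigenvalue_le hx ?_
    exact (Module.End.hasEigenvalue_iff_isRoot_charpoly f α).mpr (Polynomial.isRoot_of_mem_roots hα)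
  calc ‖f.charpoly.roots.sum‖ ≤ (f.charpoly.roots.map (‖·‖)).sum := norm_multiset_sum_le _
    _ ≤ f.charpoly.roots.card * R := by
        simpa using Multiset.sum_le_card_nsmul _ R hroots
    _ ≤ Module.finrank ℂ E * R := by
        rw [← LinearMap.charpoly_natDegree f]
        gcongr
        exact Polynomial.card_roots' _

end DualBound

section Exponential

variable {E : Type v} [AddCommGroup E] [Module ℂ E] [Module.Finite ℂ E]

attribute [local instance] Matrix.linftyOpNormedRing Matrix.linftyOpNormedAlgebra

theorem trace_expEnd (A : Module.End ℂ E) : LinearMap.trace ℂ E (VOA.expEnd A) =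
    (NormedSpace.exp (LinearMap.toMatrix (Module.finBasis ℂ E) (Module.finBasis ℂ E) A)).trace := by
  rw [VOA.expEnd, LinearMap.trace_eq_matrix_trace ℂ (Module.finBasis ℂ E), LinearMap.toMatrix_toLin]

theorem hasSum_trace_expEnd (A : Module.End ℂ E) :
    HasSum (fun k : ℕ => (k.factorial : ℂ)⁻¹ * LinearMap.trace ℂ E (A ^ k))
      (LinearMap.trace ℂ E (VOA.expEnd A)) := by
  have hexp := NormedSpace.exp_series_hasSum_exp' (𝕂 := ℂ)
    (LinearMap.toMatrix (Module.finBasis ℂ E) (Module.finBasis ℂ E) A)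
  have htrace := hexp.map (Matrix.traceAddMonoidHom _ ℂ) (Continuous.matrix_trace continuous_id)
  rw [trace_expEnd]
  refine htrace.congr_fun fun k => ?_
  simp [Matrix.trace_smul, LinearMap.trace_eq_matrix_trace ℂ (Module.finBasis ℂ E),
    LinearMap.toMatrix_pow]

theorem DualBound.norm_trace_expEnd_le {ι : Type*} [Finite ι] {x : ι → E} {A : Module.End ℂ E}
    {R : ℝ} (h : DualBound x A R) (hx : Submodule.span ℂ (Set.range x) = ⊤) (hR : 0 ≤ R) :
    ‖LinearMap.trace ℂ E (VOA.expEnd A)‖ ≤ Module.finrank ℂ E * Real.exp R := by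
  have hexp : HasSum (fun k : ℕ => Module.finrank ℂ E * (R ^ k / k.factorial))
      (Module.finrank ℂ E * Real.exp R) := by
    rw [Real.exp_eq_exp_ℝ]
    exact (NormedSpace.expSeries_div_hasSum_exp R).mul_left _
  refine (hasSum_trace_expEnd A).norm_le_of_bounded hexp fun k => ?_
  rw [norm_mul, norm_inv, Complex.norm_natCast]
  calc (k.factorial : ℝ)⁻¹ * ‖LinearMap.trace ℂ E (A ^ k)‖
      ≤ (k.factorial : ℝ)⁻¹ * (Module.finrank ℂ E * R ^ k) := by
        gcongr
        exact (h.pow k).norm_trace_le hx (pow_nonneg hR k)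
    _ = Module.finrank ℂ E * (R ^ k / k.factorial) := by ring

theorem differentiable_trace_expEnd {F : Type*} [NormedAddCommGroup F] [NormedSpace ℂ F]
    [FiniteDimensional ℂ F] (A : F →ₗ[ℂ] Module.End ℂ E) :
    Differentiable ℂ fun v => LinearMap.trace ℂ E (VOA.expEnd (A v)) := by
  let toMat := (LinearMap.toMatrix (Module.finBasis ℂ E) (Module.finBasis ℂ E)).toLinearMap ∘ₗ A
  let tr := Matrix.traceLinearMap (Fin (Module.finrank ℂ E)) ℂ ℂ
  simp only [trace_expEnd]
  have hexp : Differentiable ℂ fun v => NormedSpace.exp (toMat v) := fun v =>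
    (NormedSpace.exp_analytic (𝕂 := ℂ) (toMat v)).differentiableAt.comp v
      toMat.toContinuousLinearMap.differentiableAt
  exact tr.toContinuousLinearMap.differentiable.comp hexp

end Exponential

/-! ### Power series in `exp (2πiτ)` with holomorphic coefficients -/

section Series

variable {E : Type*} [NormedAddCommGroup E] [NormedSpace ℂ E]

theorem norm_fderiv_le_of_norm_le {f : E → ℂ} {x y : E} {r B : ℝ} (hr : 0 < r)
    (hf : DifferentiableOn ℂ f (Metric.ball x (r + r)))
    (hB : ∀ z ∈ Metric.ball x (r + r), ‖f z‖ ≤ B) (hy : y ∈ Metric.ball x r) :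
    ‖fderiv ℂ f y‖ ≤ 2 * B / r := by
  have hsub : Metric.ball y r ⊆ Metric.ball x (r + r) :=
    Metric.ball_subset_ball' (add_le_add_right (Metric.mem_ball.mp hy).le r)
  refine Complex.norm_fderiv_le_div_of_mapsTo_ball (hf.mono hsub) (fun z hz => ?_) hr
  rw [mem_closedBall_iff_norm]
  linarith [norm_sub_le (f z) (f y), hB z (hsub hz), hB y (hsub (Metric.mem_ball_self hr))]

theorem differentiableOn_tsum_of_locally_bounded {ι : Type*} {f : ι → E → ℂ} {s : Set E}
    (hf : ∀ n, DifferentiableOn ℂ (f n) s)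
    (hb : ∀ x ∈ s, ∃ t ∈ nhds x, t ⊆ s ∧ ∃ u : ι → ℝ, Summable u ∧ ∀ n, ∀ y ∈ t, ‖f n y‖ ≤ u n) :
    DifferentiableOn ℂ (fun x => ∑' n, f n x) s := by
  intro x hx
  obtain ⟨t, ht, hts, u, hu, hfu⟩ := hb x hx
  obtain ⟨R, hR, hRt⟩ := Metric.mem_nhds_iff.mp ht
  obtain ⟨r, hr, rfl⟩ : ∃ r, 0 < r ∧ R = r + r := ⟨R / 2, half_pos hR, (add_halves R).symm⟩
  have hdiff (n : ι) : DifferentiableOn ℂ (f n) (Metric.ball x (r + r)) :=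
    (hf n).mono (hRt.trans hts)
  have hsub : Metric.ball x r ⊆ Metric.ball x (r + r) := Metric.ball_subset_ball (by linarith)
  have hxr : x ∈ Metric.ball x r := Metric.mem_ball_self hr
  have := hasFDerivAt_tsum_of_isPreconnected ((hu.mul_left 2).div_const r) Metric.isOpen_ball
    (Metric.isPreconnected_ball (x := x) (r := r))
    (fun n y hy => ((hdiff n).differentiableAt (Metric.isOpen_ball.mem_nhds (hsub hy))).hasFDerivAt)
    (fun n y hy => norm_fderiv_le_of_norm_le hr (hdiff n) (fun z hz => hfu n z (hRt hz)) hy) hxr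
    (Summable.of_norm_bounded hu fun n => hfu n x (hRt (hsub hxr))) hxr
  exact this.differentiableAt.differentiableWithinAt

theorem norm_mul_exp_le {c τ : ℂ} {B ε : ℝ} (hc : ‖c‖ ≤ B) (hτ : ε ≤ τ.im) (n : ℕ) :
    ‖c * Complex.exp (2 * Real.pi * Complex.I * τ * n)‖ ≤
      B * Real.exp (-(2 * Real.pi * ε) * n) := by
  have hre : (2 * Real.pi * Complex.I * τ * n).re = -(2 * Real.pi * τ.im) * n := by simp
  rw [norm_mul, Complex.norm_exp, hre]
  have := (norm_nonneg c).trans hc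
  gcongr

theorem summable_mul_exp_of_isSubexponential {c : ℕ → ℂ} {u : ℕ → ℝ} (hu : IsSubexponential u)
    (hcu : ∀ n, ‖c n‖ ≤ u n) {τ : ℂ} (hτ : 0 < τ.im) :
    Summable fun n : ℕ => c n * Complex.exp (2 * Real.pi * Complex.I * τ * n) :=
  Summable.of_norm_bounded (hu.summable_mul_exp (by positivity)) fun n =>
    norm_mul_exp_le (hcu n) le_rfl n

theorem differentiableOn_tsum_mul_exp {c : ℕ → E → ℂ} (hc : ∀ n, Differentiable ℂ (c n))
    (hb : ∀ r, ∃ u, IsSubexponential u ∧ ∀ n v, ‖v‖ ≤ r → ‖c n v‖ ≤ u n) :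
    DifferentiableOn ℂ
      (fun p : E × ℂ => ∑' n, c n p.1 * Complex.exp (2 * Real.pi * Complex.I * p.2 * n))
      {p | 0 < p.2.im} := by
  refine differentiableOn_tsum_of_locally_bounded (fun n => ?_) fun p (hp : 0 < p.2.im) => ?_
  · have := (hc n).comp (differentiable_fst (F := ℂ))
    exact (this.mul (by fun_prop)).differentiableOn
  obtain ⟨u, hu, hcu⟩ := hb (‖p.1‖ + 1)
  refine ⟨{q | ‖q.1‖ < ‖p.1‖ + 1 ∧ p.2.im / 2 < q.2.im}, IsOpen.mem_nhds ?_ ?_, ?_, _,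
    hu.summable_mul_exp (δ := 2 * Real.pi * (p.2.im / 2)) (by positivity), fun n q hq =>
      norm_mul_exp_le (hcu n q.1 hq.1.le) hq.2.le n⟩
  · exact (isOpen_lt continuous_fst.norm continuous_const).inter
      (isOpen_lt continuous_const (Complex.continuous_im.comp continuous_snd))
  · exact ⟨lt_add_one _, half_lt_self hp⟩
  · exact fun q hq => (half_pos hp).trans hq.2

end Series

namespace VOA

open VertexOperatorAlgebra

variable {V : Type u} [AddCommGroup V] [Module ℂ V] [VertexOperatorAlgebra V]
variable {M : Type v} [AddCommGroup M] [Module ℂ M] [VOAModule V M]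

/-! ### Modes -/

variable (M) in
/-- The map `a ↦ aₙ w`. -/
def modeApply (n : ℤ) (w : M) : V →ₗ[ℂ] M where
  toFun a := mode M a n w
  map_add' a b := by rw [mode_add, LinearMap.add_apply]
  map_smul' r a := by rw [mode_smul, LinearMap.smul_apply, RingHom.id_apply]

theorem exists_forall_mode_eq_zero (a : V) (w : M) : ∃ N : ℤ, ∀ n ≥ N, mode M a n w = 0 :=
  ⟨-HahnSeries.order ((HahnModule.of ℂ).symm (VOAModule.YM (M := M) a w)), fun n hn =>
    ncoeff_eq_zero_of_lt_order _ _ _ (by omega)⟩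

theorem mode_mem_homogeneous {a b : V} {k h : ℤ} (ha : a ∈ homogeneous V k)
    (hb : b ∈ homogeneous V h) (n : ℤ) : mode V a n b ∈ homogeneous V (k + h - n - 1) := by
  have := mode_mem_weightSpace ha hb n
  rwa [show ((h : ℂ) + k - n - 1) = ((k + h - n - 1 : ℤ) : ℂ) by push_cast; ring] at this

theorem commutator_mode (a b : V) (w : M) (m n : ℤ) :
    mode M a m (mode M b n w) - mode M b n (mode M a m w) =
      ∑ᶠ j : ℕ, Ring.choose m j • mode M (mode V a j b) (m + n - j) w := by
  have h := jacobi_mode a b w 0 m n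
  rw [finsum_eq_single (fun j : ℕ => ((-1) ^ j * Ring.choose (0 : ℤ) j) • _) 0 (fun j hj => by
    rw [Ring.choose_zero_pos ℤ (Nat.pos_of_ne_zero hj), mul_zero, zero_smul])] at h
  simpa using h.symm

/-- The associativity formula, the case `m = 0` of the Jacobi identity. -/
theorem mode_mode (a b : V) (w : M) (l n : ℤ) :
    mode M (mode V a l b) n w = ∑ᶠ j : ℕ, ((-1) ^ j * Ring.choose l j) •
      (mode M a (l - j) (mode M b (n + j) w) -
        (l.negOnePow : ℤ) • mode M b (l + n - j) (mode M a j w)) := by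
  have h := jacobi_mode a b w l 0 n
  rw [finsum_eq_single _ 0 (fun j hj => by
    rw [Ring.choose_zero_pos ℤ (Nat.pos_of_ne_zero hj), zero_smul])] at h
  simpa only [Ring.choose_zero_right, one_smul, Nat.cast_zero, add_zero, zero_add, sub_zero] using h

theorem neg_one_pow_mul_choose_neg_one (j : ℕ) : (-1) ^ j * Ring.choose (-1 : ℤ) j = 1 := by
  rw [Ring.choose_neg, show (1 + (j : ℤ) - 1) = (j : ℤ) by ring, Ring.choose_natCast,
    Nat.choose_self, Int.negOnePow_def]
  rcases Nat.even_or_odd j with hj | hj <;> simp [hj.neg_one_pow, Units.smul_def]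

theorem mode_normal_product (a b : V) (w : M) (n : ℤ) :
    mode M (mode V a (-1) b) n w =
      ∑ᶠ j : ℕ, (mode M a (-1 - j) (mode M b (n + j) w) +
        mode M b (n - 1 - j) (mode M a j w)) := by
  have hs : ((-1 : ℤ).negOnePow : ℤ) = -1 := by decide
  simp only [mode_mode, neg_one_pow_mul_choose_neg_one, hs, one_smul, neg_smul, sub_neg_eq_add,
    neg_add_eq_sub]

/-! ### Homogeneous vectors acting by degree -/

variable (V) in
/-- A homogeneous vector of `V` of nonnegative weight, bundled with its weight so that its modes can
be indexed by the shift of weights they effect. -/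
structure HomogeneousVector where
  wt : ℕ
  vec : V
  mem : vec ∈ homogeneous V wt

namespace HomogeneousVector

variable (M) in
/-- The mode of `x` that shifts weights by `d`; this is `x_{wt x - 1 - d}`. -/
def op (x : HomogeneousVector V) (d : ℤ) : Module.End ℂ M := mode M x.vec (x.wt - 1 - d)

theorem op_mem_weightSpace (x : HomogeneousVector V) (d : ℤ) {μ : ℂ} {w : M}
    (hw : w ∈ weightSpace V M μ) : x.op M d w ∈ weightSpace V M (μ + d) := by
  have := mode_mem_weightSpace (M := M) x.mem hw (x.wt - 1 - d)
  rwa [show μ + ((x.wt : ℤ) : ℂ) - ((x.wt - 1 - d : ℤ) : ℂ) - 1 = μ + d by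
    push_cast; ring] at this

theorem exists_forall_op_eq_zero (x : HomogeneousVector V) (u : M) :
    ∃ N : ℤ, ∀ d ≤ N, x.op M d u = 0 := by
  obtain ⟨N, hN⟩ := exists_forall_mode_eq_zero x.vec u
  exact ⟨x.wt - 1 - N, fun d hd => hN _ (by omega)⟩

/-- The normally ordered product `x₋₁ y`. -/
def normalProduct (x y : HomogeneousVector V) : HomogeneousVector V where
  wt := x.wt + y.wt
  vec := mode V x.vec (-1) y.vec
  mem := by
    have := mode_mem_homogeneous x.mem y.mem (-1)
    rwa [show (x.wt + y.wt - -1 - 1 : ℤ) = (x.wt + y.wt : ℕ) by push_cast; ring] at this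

variable (M) in
/-- The product of `x[p]` and `y[q]` in normal order: modes `xₙ` with `n ≥ 0` act first. -/
def normalOrder (x y : HomogeneousVector V) (p q : ℤ) : Module.End ℂ M :=
  if x.wt ≤ p then x.op M p * y.op M q else y.op M q * x.op M p

theorem hasFiniteSupport_normalOrder (x y : HomogeneousVector V) (D : ℤ) (u : M) :
    (fun p : ℤ => normalOrder M x y p (D - p) u).HasFiniteSupport := by
  obtain ⟨A, hA⟩ := x.exists_forall_op_eq_zero u
  obtain ⟨B, hB⟩ := y.exists_forall_op_eq_zero u
  refine (Set.finite_Icc (min A x.wt) (max x.wt (D - B))).subset fun p hp => ?_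
  by_contra hout
  rw [Set.mem_Icc, not_and_or, not_le, not_le, lt_min_iff, max_lt_iff] at hout
  refine hp ?_
  rcases hout with ⟨hpA, hpx⟩ | ⟨hpx, hpB⟩
  · simp [normalOrder, hpx.not_ge, hA p hpA.le]
  · simp [normalOrder, hpx.le, hB (D - p) (by omega)]

theorem op_normalProduct (x y : HomogeneousVector V) (D : ℤ) (u : M) :
    (x.normalProduct y).op M D u = ∑ᶠ p : ℤ, normalOrder M x y p (D - p) u := by
  rw [finsum_int_eq_finsum_nat (hasFiniteSupport_normalOrder x y D u) x.wt, op, normalProduct,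
    mode_normal_product]
  refine finsum_congr fun j => ?_
  rw [normalOrder, if_pos (by omega), normalOrder, if_neg (by omega)]
  simp only [Module.End.mul_apply, op]
  rw [show (x.wt - 1 - (x.wt + j) : ℤ) = -1 - j by ring,
    show (y.wt - 1 - (D - (x.wt + j)) : ℤ) = (x.wt + y.wt : ℕ) - 1 - D + j by push_cast; ring,
    show (y.wt - 1 - (D - (x.wt - 1 - j)) : ℤ) = (x.wt + y.wt : ℕ) - 1 - D - 1 - j by
      push_cast; ring,
    show (x.wt - 1 - (x.wt - 1 - j) : ℤ) = j by ring]

theorem mode_mode_mem [IsCFTType V] (x y : HomogeneousVector V) {i n d : ℤ} {u : M}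
    {Z : Submodule ℂ M} (hd : d = x.wt + y.wt - i - 2 - n)
    (hZ : ∀ z : HomogeneousVector V, z.wt = x.wt + y.wt - i - 1 → z.op M d u ∈ Z) :
    mode M (mode V x.vec i y.vec) n u ∈ Z := by
  have hmem := mode_mem_homogeneous x.mem y.mem i
  rcases lt_or_ge (x.wt + y.wt - i - 1 : ℤ) 0 with hneg | hpos
  · rw [IsCFTType.homogeneous_neg _ hneg, Submodule.mem_bot] at hmem
    rw [hmem, mode_zero, LinearMap.zero_apply]
    exact Z.zero_mem
  · obtain ⟨k, hk⟩ := Int.eq_ofNat_of_zero_le hpos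
    rw [hk] at hmem
    have := hZ ⟨k, mode V x.vec i y.vec, hmem⟩ hk.symm
    rwa [op, show (k - 1 - d : ℤ) = n by omega] at this

theorem op_commutator_mem [IsCFTType V] (x y : HomogeneousVector V) (p q : ℤ) (u : M)
    {Z : Submodule ℂ M}
    (hZ : ∀ z : HomogeneousVector V, z.wt < x.wt + y.wt → z.op M (p + q) u ∈ Z) :
    x.op M p (y.op M q u) - y.op M q (x.op M p u) ∈ Z := by
  rw [op, op, commutator_mode]
  exact finsum_mem_of_forall_mem fun j => Z.toAddSubgroup.zsmul_mem
    (mode_mode_mem x y (by omega) fun z hz => hZ z (by omega)) _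

/-- The coefficient of `x[d] y[d]` in `(x₋₁ y)[2d]` is `1`, so this product can be expressed through
the terms `x[p] y[q]` with `p ≠ q`. -/
theorem op_op_self_mem [IsCFTType V] (x y : HomogeneousVector V) (d : ℤ) (u : M)
    {Z : Submodule ℂ M}
    (hcomm : ∀ z : HomogeneousVector V, z.wt < x.wt + y.wt → z.op M (d + d) u ∈ Z)
    (hprod : (x.normalProduct y).op M (d + d) u ∈ Z)
    (hoff : ∀ p q : ℤ, p + q = d + d → p ≠ d → x.op M p (y.op M q u) ∈ Z) :
    x.op M d (y.op M d u) ∈ Z := by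
  have hreorder : ∀ p q : ℤ, p + q = d + d →
      (normalOrder M x y p q u ∈ Z ↔ x.op M p (y.op M q u) ∈ Z) := fun p q hpq => by
    rw [normalOrder]
    split_ifs
    · rfl
    · exact (mem_iff_mem_of_sub_mem
        (op_commutator_mem x y p q u fun z hz => hpq ▸ hcomm z hz)).symm
  rw [op_normalProduct] at hprod
  have := mem_of_finsum_mem (hasFiniteSupport_normalOrder x y (d + d) u) hprod d fun p hp =>
    (hreorder p _ (by ring)).mpr (hoff p _ (by ring) hp)
  rwa [hreorder d _ (by ring), add_sub_cancel_right] at this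

theorem mode_derived_product_mem {x y : HomogeneousVector V} {n d : ℤ} {u : M} {Z : Submodule ℂ M}
    (hd : d = x.wt + y.wt - n)
    (hZ : ∀ p q : ℤ, p + q = d → x.op M p (y.op M q u) ∈ Z ∧ y.op M q (x.op M p u) ∈ Z) :
    mode M (mode V x.vec (-2) y.vec) n u ∈ Z := by
  rw [mode_mode]
  refine finsum_mem_of_forall_mem fun j => Z.toAddSubgroup.zsmul_mem
    (Z.sub_mem ?_ (Z.toAddSubgroup.zsmul_mem ?_ _)) _
  · have := (hZ (x.wt + 1 + j) (y.wt - 1 - n - j) (by omega)).1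
    rwa [op, op, show (x.wt - 1 - (x.wt + 1 + j) : ℤ) = -2 - j by ring,
      show (y.wt - 1 - (y.wt - 1 - n - j) : ℤ) = n + j by ring] at this
  · have := (hZ (x.wt - 1 - j) (y.wt - 1 - (-2 + n - j)) (by omega)).2
    rwa [op, op, sub_sub_cancel, sub_sub_cancel] at this

theorem mode_zero_op (a : V) (x : HomogeneousVector V) (d : ℤ) (u : M) :
    mode M a 0 (x.op M d u) =
      x.op M d (mode M a 0 u) + mode M (mode V a 0 x.vec) (x.wt - 1 - d) u := by
  have h := commutator_mode a x.vec u 0 (x.wt - 1 - d)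
  rw [finsum_eq_single _ 0 (fun j hj => by
    rw [Ring.choose_zero_pos ℤ (Nat.pos_of_ne_zero hj), zero_smul])] at h
  simp only [Ring.choose_zero_right, one_smul, Nat.cast_zero, zero_add, sub_zero] at h
  rw [← h, op, add_sub_cancel]

end HomogeneousVector

/-! ### Words -/

variable (V) in
/-- A product of modes `x₁[d₁] ⋯ xᵣ[dᵣ]`, encoded as the list of the pairs `(xᵢ, dᵢ)`, where `x[d]`
is the mode `HomogeneousVector.op` of `x` that shifts weights by `d`. -/
abbrev Word : Type u := List (HomogeneousVector V × ℤ)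

namespace Word

variable (M) in
/-- The operator on `M` that a word stands for. -/
def op (l : Word V) : Module.End ℂ M := (l.map fun p => p.1.op M p.2).prod

/-- The total weight of the vectors in a word. -/
def wt (l : Word V) : ℕ := (l.map fun p => p.1.wt).sum

/-- The total shift of weights by a word. -/
def degree (l : Word V) : ℤ := (l.map Prod.snd).sum

/-- The sum of the squares of the degrees in a word; for a given length and total degree it measures
how far these are apart. -/
def sqDegree (l : Word V) : ℤ := (l.map fun p => p.2 ^ 2).sum

@[simp] theorem op_nil : op M ([] : Word V) = 1 := rfl

@[simp] theorem op_cons (p : HomogeneousVector V × ℤ) (l : Word V) :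
    op M (p :: l) = p.1.op M p.2 * op M l := by simp [op]

@[simp] theorem op_append (l l' : Word V) : op M (l ++ l') = op M l * op M l' := by simp [op]

@[simp] theorem wt_nil : wt ([] : Word V) = 0 := rfl

@[simp] theorem wt_cons (p : HomogeneousVector V × ℤ) (l : Word V) :
    wt (p :: l) = p.1.wt + wt l := by simp [wt]

@[simp] theorem wt_append (l l' : Word V) : wt (l ++ l') = wt l + wt l' := by simp [wt]

@[simp] theorem degree_nil : degree ([] : Word V) = 0 := rfl

@[simp] theorem degree_cons (p : HomogeneousVector V × ℤ) (l : Word V) :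
    degree (p :: l) = p.2 + degree l := by simp [degree]

@[simp] theorem degree_append (l l' : Word V) : degree (l ++ l') = degree l + degree l' := by
  simp [degree]

@[simp] theorem sqDegree_nil : sqDegree ([] : Word V) = 0 := rfl

@[simp] theorem sqDegree_cons (p : HomogeneousVector V × ℤ) (l : Word V) :
    sqDegree (p :: l) = p.2 ^ 2 + sqDegree l := by simp [sqDegree]

@[simp] theorem sqDegree_append (l l' : Word V) :
    sqDegree (l ++ l') = sqDegree l + sqDegree l' := by simp [sqDegree]

theorem wt_eq_of_perm {l l' : Word V} (h : l.Perm l') : wt l = wt l' := (h.map _).sum_eq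

theorem degree_eq_of_perm {l l' : Word V} (h : l.Perm l') : degree l = degree l' :=
  (h.map _).sum_eq

theorem sqDegree_eq_of_perm {l l' : Word V} (h : l.Perm l') : sqDegree l = sqDegree l' :=
  (h.map _).sum_eq

theorem degree_nonneg {l : Word V} (h : ∀ p ∈ l, 0 ≤ p.2) : 0 ≤ degree l :=
  List.sum_nonneg (List.forall_mem_map.mpr h)

theorem sqDegree_le_degree_sq {l : Word V} (h : ∀ p ∈ l, 0 ≤ p.2) :
    sqDegree l ≤ degree l ^ 2 := by
  induction l with
  | nil => simp
  | cons p l ih =>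
    rw [List.forall_mem_cons] at h
    simp only [sqDegree_cons, degree_cons]
    nlinarith [ih h.2, mul_nonneg h.1 (degree_nonneg h.2)]

theorem sqDegree_append_pair_lt {l : Word V} (x y : HomogeneousVector V) {d p q : ℤ}
    (hpq : p + q = d + d) (hne : p ≠ d) :
    sqDegree (l ++ [(x, d), (y, d)]) < sqDegree (l ++ [(x, p), (y, q)]) := by
  obtain rfl : q = d + d - p := by omega
  simp only [sqDegree_append, sqDegree_cons, sqDegree_nil]
  nlinarith [sq_pos_of_ne_zero (sub_ne_zero.mpr hne)]

theorem op_mem_weightSpace {l : Word V} {μ : ℂ} {w : M} (hw : w ∈ weightSpace V M μ) :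
    op M l w ∈ weightSpace V M (μ + degree l) := by
  induction l with
  | nil => simpa using hw
  | cons p l ih =>
    rw [op_cons, Module.End.mul_apply, degree_cons, Int.cast_add, add_comm (p.2 : ℂ), ← add_assoc]
    exact p.1.op_mem_weightSpace p.2 ih

variable (V) in
/-- The span of the vectors `l w` with `w ∈ W` and a word `l` of weight less than `s` and degree
`D`, containing the error terms that arise when words of weight `s` are rewritten. -/
def lowerSpan (W : Submodule ℂ M) (s : ℕ) (D : ℤ) : Submodule ℂ M :=
  Submodule.span ℂ {m | ∃ l : Word V, ∃ w ∈ W, wt l < s ∧ degree l = D ∧ m = op M l w}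

variable {W : Submodule ℂ M} {w : M}

theorem op_mem_lowerSpan {l : Word V} {s : ℕ} {D : ℤ} (hw : w ∈ W) (hs : wt l < s)
    (hD : degree l = D) : op M l w ∈ lowerSpan V W s D :=
  Submodule.subset_span ⟨l, w, hw, hs, hD, rfl⟩

theorem op_apply_mem_lowerSpan {s : ℕ} {D : ℤ} (l : Word V) {m : M} (hm : m ∈ lowerSpan V W s D) :
    op M l m ∈ lowerSpan V W (wt l + s) (degree l + D) := by
  suffices lowerSpan V W s D ≤ (lowerSpan V W (wt l + s) (degree l + D)).comap (op M l) from
    this hm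
  refine Submodule.span_le.mpr ?_
  rintro _ ⟨l', w, hw, hs, rfl, rfl⟩
  rw [SetLike.mem_coe, Submodule.mem_comap, ← Module.End.mul_apply, ← op_append]
  exact op_mem_lowerSpan hw (by rw [wt_append]; omega) (degree_append l l')

theorem op_sub_op_mem_lowerSpan_of_perm [IsCFTType V] {l l' : Word V} (h : l.Perm l')
    (hw : w ∈ W) : op M l w - op M l' w ∈ lowerSpan V W (wt l) (degree l) := by
  induction h with
  | nil => simp
  | @cons p l l' h ih => simpa using op_apply_mem_lowerSpan [p] ih
  | swap p q l =>
    simp only [op_cons, Module.End.mul_apply]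
    refine q.1.op_commutator_mem p.1 q.2 p.2 _ fun z hz => ?_
    have := op_mem_lowerSpan (l := (z, q.2 + p.2) :: l) hw
      (show _ < wt (q :: p :: l) by simp only [wt_cons]; omega)
      (show _ = degree (q :: p :: l) by simp only [degree_cons]; ring)
    simpa only [op_cons, Module.End.mul_apply] using this
  | trans h₁ _ ih₁ ih₂ =>
    rw [← wt_eq_of_perm h₁, ← degree_eq_of_perm h₁] at ih₂
    simpa using Submodule.add_mem _ ih₁ ih₂

theorem op_mem_iff_of_perm [IsCFTType V] {Z : Submodule ℂ M} {l l' : Word V} (h : l.Perm l')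
    (hZ : lowerSpan V W (wt l) (degree l) ≤ Z) (hw : w ∈ W) : op M l w ∈ Z ↔ op M l' w ∈ Z :=
  mem_iff_mem_of_sub_mem (hZ (op_sub_op_mem_lowerSpan_of_perm h hw))

theorem op_mem_lowerSpan_of_neg [IsCFTType V]
    (hW : ∀ (x : HomogeneousVector V), ∀ d < 0, ∀ w ∈ W, x.op M d w = 0) {l : Word V}
    (hl : ∃ p ∈ l, p.2 < 0) (hw : w ∈ W) : op M l w ∈ lowerSpan V W (wt l) (degree l) := by
  obtain ⟨p, hp, hneg⟩ := hl
  obtain ⟨l', hl'⟩ := exists_perm_append_singleton_of_mem hp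
  rw [op_mem_iff_of_perm hl' le_rfl hw, op_append, Module.End.mul_apply, op_cons, op_nil, mul_one,
    hW p.1 p.2 hneg w hw, map_zero]
  exact Submodule.zero_mem _

end Word

variable (V) in
/-- The part of `C₂(V)` of weight `k`. -/
def derivedSpan (k : ℕ) : Submodule ℂ V :=
  Submodule.span ℂ {c | ∃ x y : HomogeneousVector V, x.wt + y.wt + 1 = k ∧
    c = mode V x.vec (-2) y.vec}

theorem derivedSpan_le_homogeneous (k : ℕ) : derivedSpan V k ≤ homogeneous V k := by
  refine Submodule.span_le.mpr ?_
  rintro _ ⟨x, y, rfl, rfl⟩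
  have := mode_mem_homogeneous x.mem y.mem (-2)
  rwa [show (x.wt + y.wt - -2 - 1 : ℤ) = (x.wt + y.wt + 1 : ℕ) by push_cast; ring] at this

theorem HomogeneousVector.op_mem_of_mem_derivedSpan {z : HomogeneousVector V}
    (hz : z.vec ∈ derivedSpan V z.wt) {d : ℤ} {u : M} {Z : Submodule ℂ M}
    (hZ : ∀ (x y : HomogeneousVector V) (p q : ℤ), x.wt + y.wt < z.wt → p + q = d →
      x.op M p (y.op M q u) ∈ Z) :
    z.op M d u ∈ Z := by
  suffices derivedSpan V z.wt ≤ Z.comap (modeApply M (z.wt - 1 - d) u) from this hz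
  refine Submodule.span_le.mpr ?_
  rintro _ ⟨x, y, hwt, rfl⟩
  exact mode_derived_product_mem (by omega) fun p q hpq =>
    ⟨hZ x y p q (by omega) hpq, hZ y x q p (by omega) (by omega)⟩

namespace Word

variable {W : Submodule ℂ M} {w : M}

theorem op_mem_lowerSpan_of_mem_derivedSpan [IsCFTType V] {l : Word V}
    (hl : ∃ p ∈ l, p.1.vec ∈ derivedSpan V p.1.wt) (hw : w ∈ W) :
    op M l w ∈ lowerSpan V W (wt l) (degree l) := by
  obtain ⟨⟨z, d⟩, hp, hz⟩ := hl
  obtain ⟨l', hl'⟩ := exists_perm_append_singleton_of_mem hp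
  rw [op_mem_iff_of_perm hl' le_rfl hw, op_append, op_cons, op_nil, mul_one, wt_eq_of_perm hl',
    degree_eq_of_perm hl']
  refine (z.op_mem_of_mem_derivedSpan hz fun x y p q hwt hdeg => ?_ :
    z.op M d w ∈ (lowerSpan V W _ _).comap (op M l'))
  have := op_mem_lowerSpan (l := l' ++ [(x, p), (y, q)]) hw
    (show _ < wt (l' ++ [(z, d)]) by simpa using hwt)
    (show _ = degree (l' ++ [(z, d)]) by simpa using hdeg)
  simpa using this

theorem op_append_pair_mem [IsCFTType V] {Z : Submodule ℂ M} {l : Word V}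
    {x y : HomogeneousVector V} {d : ℤ} (hw : w ∈ W)
    (hlow : lowerSpan V W (wt (l ++ [(x, d), (y, d)])) (degree (l ++ [(x, d), (y, d)])) ≤ Z)
    (hprod : op M (l ++ [(x.normalProduct y, d + d)]) w ∈ Z)
    (hoff : ∀ p q : ℤ, p + q = d + d → p ≠ d → op M (l ++ [(x, p), (y, q)]) w ∈ Z) :
    op M (l ++ [(x, d), (y, d)]) w ∈ Z := by
  simp only [op_append, op_cons, op_nil, mul_one, Module.End.mul_apply] at hprod hoff ⊢
  refine (x.op_op_self_mem y d w (fun z hz => ?_) hprod hoff :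
    x.op M d (y.op M d w) ∈ Z.comap (op M l))
  have := op_mem_lowerSpan (l := l ++ [(z, d + d)]) hw
    (show _ < wt (l ++ [(x, d), (y, d)]) by simpa using hz)
    (show _ = degree (l ++ [(x, d), (y, d)]) by simp)
  simpa using hlow this

/-- Words in vectors of weight at most `K` with nonnegative, strictly decreasing degrees. -/
def IsReduced (K : ℕ) (l : Word V) : Prop :=
  (∀ p ∈ l, p.1.wt ≤ K ∧ 0 ≤ p.2) ∧ l.Pairwise fun p q => q.2 < p.2

variable (V) in
/-- The span of the vectors `l w` with `w ∈ W` and a reduced word `l` of degree `D`. -/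
def reducedSpan (W : Submodule ℂ M) (K : ℕ) (D : ℤ) : Submodule ℂ M :=
  Submodule.span ℂ {m | ∃ l : Word V, ∃ w ∈ W, IsReduced K l ∧ degree l = D ∧ m = op M l w}

theorem exists_perm_isReduced {K : ℕ} {l : Word V} (hl : ∀ p ∈ l, p.1.wt ≤ K ∧ 0 ≤ p.2)
    (hnodup : (l.map Prod.snd).Nodup) : ∃ l', l.Perm l' ∧ IsReduced K l' := by
  let r (p q : HomogeneousVector V × ℤ) : Prop := q.2 ≤ p.2
  have : Std.Total r := ⟨fun p q => le_total q.2 p.2⟩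
  have : IsTrans _ r := ⟨fun p q s hpq hqs => le_trans hqs hpq⟩
  have hperm := List.perm_insertionSort r l
  refine ⟨l.insertionSort r, hperm.symm, fun p hp => hl p (hperm.mem_iff.mp hp), ?_⟩
  have hne : (l.insertionSort r).Pairwise fun p q => p.2 ≠ q.2 :=
    List.pairwise_map.mp ((hperm.map Prod.snd).nodup_iff.mpr hnodup)
  exact (List.pairwise_insertionSort r l).imp₂ (fun p q hle hne => lt_of_le_of_ne hle hne.symm) hne

theorem op_mem_lowerSpan_or_forall_mem [IsCFTType V] {K : ℕ}
    (hW : ∀ (x : HomogeneousVector V), ∀ d < 0, ∀ w ∈ W, x.op M d w = 0)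
    (hK : ∀ k > K, homogeneous V k ≤ derivedSpan V k) (l : Word V) (hw : w ∈ W) :
    op M l w ∈ lowerSpan V W (wt l) (degree l) ∨ ∀ p ∈ l, p.1.wt ≤ K ∧ 0 ≤ p.2 := by
  refine or_iff_not_imp_right.mpr fun h => ?_
  push Not at h
  obtain ⟨p, hp, h⟩ := h
  rcases le_or_gt p.1.wt K with hle | hlt
  · exact op_mem_lowerSpan_of_neg hW ⟨p, hp, h hle⟩ hw
  · exact op_mem_lowerSpan_of_mem_derivedSpan ⟨p, hp, hK _ hlt p.1.mem⟩ hw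

/-- Modulo words of smaller weight, the modes in a word may be permuted.  A word with two modes of
equal degree is rewritten by `op_append_pair_mem`, into a shorter word and into words whose degrees
are further apart. -/
theorem op_mem_reducedSpan [IsCFTType V] {K : ℕ}
    (hW : ∀ (x : HomogeneousVector V), ∀ d < 0, ∀ w ∈ W, x.op M d w = 0)
    (hK : ∀ k > K, homogeneous V k ≤ derivedSpan V k) (l : Word V) {w : M} (hw : w ∈ W) :
    op M l w ∈ reducedSpan V W K (degree l) := by
  have hlow : lowerSpan V W (wt l) (degree l) ≤ reducedSpan V W K (degree l) := by
    refine Submodule.span_le.mpr ?_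
    rintro _ ⟨l', w', hw', hwt, hdeg, rfl⟩
    exact hdeg ▸ op_mem_reducedSpan hW hK l' hw'
  obtain hmem | hl := op_mem_lowerSpan_or_forall_mem hW hK l hw
  · exact hlow hmem
  by_cases hnodup : (l.map Prod.snd).Nodup
  · obtain ⟨l', hl', hred⟩ := exists_perm_isReduced hl hnodup
    rw [op_mem_iff_of_perm hl' hlow hw]
    exact Submodule.subset_span ⟨l', w, hw, hred, (degree_eq_of_perm hl').symm, rfl⟩
  obtain ⟨l', ⟨x, d⟩, ⟨y, _⟩, hl', rfl⟩ := exists_perm_append_pair_of_not_nodup_map hnodup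
  have hwt := wt_eq_of_perm hl'
  have hdeg := degree_eq_of_perm hl'
  have hlen := hl'.length_eq
  have hmax := sqDegree_le_degree_sq fun p hp => (hl p hp).2
  rw [op_mem_iff_of_perm hl' hlow hw]
  refine op_append_pair_mem hw (by rwa [← hwt, ← hdeg]) ?_ fun p q hpq hne => ?_
  · have hdeg' : degree (l' ++ [(x.normalProduct y, d + d)]) = degree l := by simp [hdeg]
    have := op_mem_reducedSpan hW hK (l' ++ [(x.normalProduct y, d + d)]) hw
    rwa [hdeg'] at this
  · have hdeg' : degree (l' ++ [(x, p), (y, q)]) = degree l := by simp [hdeg, hpq]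
    have hsq := sqDegree_eq_of_perm hl' ▸ sqDegree_append_pair_lt (l := l') x y hpq hne
    have := op_mem_reducedSpan hW hK (l' ++ [(x, p), (y, q)]) hw
    rwa [hdeg'] at this
termination_by (wt l, l.length, (degree l ^ 2 - sqDegree l + 1).toNat)
decreasing_by
  · exact Prod.Lex.left _ _ hwt
  · simp [Prod.lex_def, hwt, hlen, HomogeneousVector.normalProduct]
  · rw [Prod.lex_def, Prod.lex_def]
    exact Or.inr ⟨by simp [hwt], Or.inr ⟨by simp [hlen], by dsimp only; rw [hdeg']; omega⟩⟩

end Word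

/-! ### `C₂`-cofiniteness -/

section Homogeneous

variable (V) in
theorem isInternal_homogeneous : DirectSum.IsInternal fun n : ℤ => homogeneous V n := graded

variable (V) in
theorem iSupIndep_homogeneous : iSupIndep fun k : ℕ => homogeneous V k :=
  (isInternal_homogeneous V).submodule_iSupIndep.comp Nat.cast_injective

variable [IsCFTType V]

variable (V) in
theorem iSup_homogeneous : ⨆ k : ℕ, homogeneous V k = ⊤ := by
  refine top_le_iff.mp ((isInternal_homogeneous V).submodule_iSup_eq_top ▸ iSup_le fun n => ?_)
  rcases lt_or_ge n 0 with hn | hn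
  · rw [IsCFTType.homogeneous_neg n hn]
    exact bot_le
  · obtain ⟨k, rfl⟩ := Int.eq_ofNat_of_zero_le hn
    exact le_iSup (fun k : ℕ => homogeneous V k) k

theorem mem_of_forall_homogeneousVector_mem {Z : Submodule ℂ V}
    (h : ∀ x : HomogeneousVector V, x.vec ∈ Z) (a : V) : a ∈ Z :=
  (iSup_homogeneous V ▸ iSup_le fun k b hb => h ⟨k, b, hb⟩ : ⊤ ≤ Z) Submodule.mem_top

theorem C₂_le_iSup_derivedSpan : C₂ V ≤ ⨆ k, derivedSpan V k := by
  refine Submodule.span_le.mpr ?_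
  rintro _ ⟨a, b, rfl⟩
  refine (mem_of_forall_homogeneousVector_mem (fun x => ?_) a :
    a ∈ (⨆ k, derivedSpan V k).comap (modeApply V (-2) b))
  refine (mem_of_forall_homogeneousVector_mem (fun y => ?_) b :
    b ∈ (⨆ k, derivedSpan V k).comap (mode V x.vec (-2)))
  exact Submodule.mem_iSup_of_mem (x.wt + y.wt + 1) (Submodule.subset_span ⟨x, y, rfl, rfl⟩)

variable (V) in
theorem exists_homogeneous_le_derivedSpan [Module.Finite ℂ (V ⧸ C₂ V)] :
    ∃ K : ℕ, ∀ k > K, homogeneous V k ≤ derivedSpan V k := by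
  obtain ⟨t, ht⟩ := exists_finset_forall_notMem_eq (iSupIndep_homogeneous V) (iSup_homogeneous V)
    derivedSpan_le_homogeneous C₂_le_iSup_derivedSpan
  exact ⟨t.sup id, fun k hk => (ht k fun hkt => hk.not_ge (Finset.le_sup (f := id) hkt)).ge⟩

end Homogeneous

/-! ### Weight spaces of an irreducible module -/

theorem exists_lowest_weight [IsOrdinaryModule V M] [Nontrivial M] :
    ∃ μ : ℂ, weightSpace V M μ ≠ ⊥ ∧ ∀ n : ℤ, n < 0 → weightSpace V M (μ + n) = ⊥ := by
  obtain ⟨μ, hμ⟩ : ∃ μ, weightSpace V M μ ≠ ⊥ := by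
    by_contra! h
    have := (IsOrdinaryModule.internal (V := V) (M := M)).submodule_iSup_eq_top
    rw [iSup_congr h, iSup_bot] at this
    exact bot_ne_top this
  obtain ⟨N, hN⟩ := IsOrdinaryModule.bounded_below (V := V) (M := M) μ
  obtain ⟨n, hn, hmin⟩ := Int.exists_least_of_bdd (P := fun n => weightSpace V M (μ + n) ≠ ⊥)
    ⟨N, fun z hz => not_lt.mp fun h => hz (hN z h)⟩ ⟨0, by simpa using hμ⟩
  refine ⟨μ + n, hn, fun m hm => ?_⟩
  by_contra h
  have := hmin (n + m) (by push_cast; rwa [← add_assoc])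
  omega

namespace Word

theorem reducedSpan_le_weightSpace {μ : ℂ} (K : ℕ) (D : ℤ) :
    reducedSpan V (weightSpace V M μ) K D ≤ weightSpace V M (μ + D) := by
  refine Submodule.span_le.mpr ?_
  rintro _ ⟨l, w, hw, -, rfl, rfl⟩
  exact op_mem_weightSpace hw

theorem reducedSpan_of_neg (W : Submodule ℂ M) (K : ℕ) {D : ℤ} (hD : D < 0) :
    reducedSpan V W K D = ⊥ := by
  refine le_bot_iff.mp (Submodule.span_le.mpr ?_)
  rintro _ ⟨l, w, -, hl, rfl, rfl⟩
  exact absurd (degree_nonneg fun p hp => (hl.1 p hp).2) hD.not_ge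

theorem span_op_eq_top [IsCFTType V] (hM : IsIrreducibleModule V M) {W : Submodule ℂ M}
    (hW : W ≠ ⊥) : Submodule.span ℂ {m | ∃ l : Word V, ∃ w ∈ W, m = op M l w} = ⊤ := by
  set T := Submodule.span ℂ {m | ∃ l : Word V, ∃ w ∈ W, m = op M l w}
  have hstable : IsVSubmodule V T := by
    intro a n m hm
    refine (mem_of_forall_homogeneousVector_mem (fun x => ?_) a : a ∈ T.comap (modeApply M n m))
    refine (Submodule.span_le.mpr ?_ : T ≤ T.comap (mode M x.vec n)) hm
    rintro _ ⟨l, w, hw, rfl⟩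
    refine Submodule.subset_span ⟨(x, x.wt - 1 - n) :: l, w, hw, ?_⟩
    rw [op_cons, Module.End.mul_apply, HomogeneousVector.op, sub_sub_cancel]
  refine (hM.2 T hstable).resolve_left fun hbot => hW (le_bot_iff.mp fun w hw => ?_)
  exact hbot ▸ Submodule.subset_span ⟨[], w, hw, rfl⟩

theorem iSup_reducedSpan_eq_top [IsCFTType V] (hM : IsIrreducibleModule V M) {W : Submodule ℂ M}
    (hW0 : W ≠ ⊥) {K : ℕ} (hW : ∀ (x : HomogeneousVector V), ∀ d < 0, ∀ w ∈ W, x.op M d w = 0)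
    (hK : ∀ k > K, homogeneous V k ≤ derivedSpan V k) :
    ⨆ n : ℕ, reducedSpan V W K n = ⊤ := by
  rw [← top_le_iff, ← span_op_eq_top hM hW0]
  refine Submodule.span_le.mpr ?_
  rintro _ ⟨l, w, hw, rfl⟩
  have hmem := op_mem_reducedSpan hW hK l hw
  rcases lt_or_ge (degree l) 0 with hD | hD
  · rw [reducedSpan_of_neg _ _ hD, Submodule.mem_bot] at hmem
    exact hmem ▸ Submodule.zero_mem _
  · obtain ⟨n, hn⟩ := Int.eq_ofNat_of_zero_le hD
    exact Submodule.mem_iSup_of_mem n (hn ▸ hmem)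

theorem exists_weightSpace_eq_reducedSpan [IsCFTType V] [Module.Finite ℂ (V ⧸ C₂ V)]
    [IsOrdinaryModule V M] (hM : IsIrreducibleModule V M) :
    ∃ (K : ℕ) (μ : ℂ),
      (∀ n : ℕ, weightSpace V M (μ + n) = reducedSpan V (weightSpace V M μ) K n) ∧
      ∀ ν, (∀ n : ℕ, μ + n ≠ ν) → weightSpace V M ν = ⊥ := by
  have := hM.1
  obtain ⟨μ, hμ, hlow⟩ := exists_lowest_weight (V := V) (M := M)
  obtain ⟨K, hK⟩ := exists_homogeneous_le_derivedSpan V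
  have hkill : ∀ (x : HomogeneousVector V), ∀ d < 0, ∀ w ∈ weightSpace V M μ, x.op M d w = 0 :=
    fun x d hd w hw => (Submodule.mem_bot ℂ).mp (hlow d hd ▸ x.op_mem_weightSpace d hw)
  let B : ℂ → Submodule ℂ M := fun ν =>
    ⨆ (n : ℕ) (_ : μ + n = ν), reducedSpan V (weightSpace V M μ) K n
  have hBle : B ≤ weightSpace V M := by
    rintro _
    refine iSup₂_le fun n hn => ?_
    have := reducedSpan_le_weightSpace (V := V) (M := M) (μ := μ) K n
    rwa [Int.cast_natCast, hn] at this
  have hBtop : ⨆ ν, B ν = ⊤ := by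
    rw [← top_le_iff, ← iSup_reducedSpan_eq_top hM hμ hkill hK]
    exact iSup_le fun n => le_iSup_of_le (μ + n) (le_iSup₂_of_le n rfl le_rfl)
  have hB : B = weightSpace V M := (IsOrdinaryModule.internal.submodule_iSupIndep
    |>.le_iff_eq_of_iSup_eq_top hBtop).mp hBle
  refine ⟨K, μ, fun n => ?_, fun ν hν => ?_⟩
  · refine (congrFun hB _).symm.trans
      (le_antisymm (iSup₂_le fun m hm => ?_) (le_iSup₂_of_le n rfl le_rfl))
    rw [show m = n by exact_mod_cast add_left_cancel hm]
  · rw [← hB, ← le_bot_iff]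
    exact iSup₂_le fun n hn => absurd hn (hν n)

end Word

/-! ### Reduced words in basis vectors -/

instance (n : ℤ) : Module.Finite ℂ (weightSpace V V (n : ℂ)) := finite_graded n

instance : Module.Finite ℂ (WeightOne V) := finite_graded 1

variable (V) in
/-- Labels for the vectors of chosen bases of `V_0, …, V_K`. -/
abbrev BasisIndex (K : ℕ) : Type :=
  Σ k : Fin (K + 1), Fin (Module.finrank ℂ (homogeneous V (k : ℕ)))

/-- The basis vector with a given label. -/
def basisVector {K : ℕ} (i : BasisIndex V K) : HomogeneousVector V :=
  ⟨i.1, Module.finBasis ℂ (homogeneous V (i.1 : ℕ)) i.2, Subtype.property _⟩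

theorem HomogeneousVector.op_mem_span_basisVector {K : ℕ} {x : HomogeneousVector V} (hx : x.wt ≤ K)
    (d : ℤ) (u : M) :
    x.op M d u ∈
      Submodule.span ℂ (Set.range fun i : BasisIndex V K => (basisVector i).op M d u) := by
  let evalOp := modeApply M (x.wt - 1 - d) u ∘ₗ (homogeneous V x.wt).subtype
  have hrepr := congrArg evalOp ((Module.finBasis ℂ (homogeneous V x.wt)).sum_repr ⟨x.vec, x.mem⟩)
  rw [show x.op M d u = evalOp ⟨x.vec, x.mem⟩ from rfl, ← hrepr, map_sum]
  refine Submodule.sum_mem _ fun i _ => ?_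
  rw [map_smul]
  exact Submodule.smul_mem _ _ (Submodule.subset_span ⟨⟨⟨x.wt, Nat.lt_succ_of_le hx⟩, i⟩, rfl⟩)

namespace Word

variable {K : ℕ}

/-- The word in basis vectors with the given labels and degrees. -/
def ofBasis (l : List (BasisIndex V K × ℕ)) : Word V := l.map fun p => (basisVector p.1, p.2)

theorem op_ofBasis_cons (p : BasisIndex V K × ℕ) (l : List (BasisIndex V K × ℕ)) (u : M) :
    op M (ofBasis (p :: l)) u = (basisVector p.1).op M p.2 (op M (ofBasis l) u) := by
  simp [ofBasis]

theorem degree_ofBasis (l : List (BasisIndex V K × ℕ)) :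
    degree (ofBasis l) = ((l.map Prod.snd).sum : ℕ) := by
  simp [degree, ofBasis, Function.comp_def]

theorem op_mem_span_ofBasis {ι : Type*} {b : ι → M} {l : Word V}
    (hl : ∀ p ∈ l, p.1.wt ≤ K ∧ 0 ≤ p.2) {w : M} (hw : w ∈ Submodule.span ℂ (Set.range b)) :
    op M l w ∈ Submodule.span ℂ {m | ∃ (l' : List (BasisIndex V K × ℕ)) (j : ι),
      l'.map (fun p => (p.2 : ℤ)) = l.map Prod.snd ∧ m = op M (ofBasis l') (b j)} := by
  induction l with
  | nil =>
    refine Submodule.span_mono ?_ hw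
    rintro _ ⟨j, rfl⟩
    exact ⟨[], j, rfl, rfl⟩
  | cons p l ih =>
    obtain ⟨⟨hwt, hdeg⟩, hl⟩ := List.forall_mem_cons.mp hl
    obtain ⟨d, hd⟩ := Int.eq_ofNat_of_zero_le hdeg
    rw [op_cons, Module.End.mul_apply]
    rw [← Submodule.mem_comap]
    refine Submodule.span_le.mpr ?_ (ih hl)
    rintro _ ⟨l', j, hl', rfl⟩
    refine Submodule.span_mono ?_ (p.1.op_mem_span_basisVector hwt p.2 (op M (ofBasis l') (b j)))
    rintro _ ⟨i, rfl⟩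
    exact ⟨(i, d) :: l', j, by simp [hl', hd], by rw [op_ofBasis_cons, hd]⟩

end Word

section Reduced

variable [IsOrdinaryModule V M] {K : ℕ} {μ : ℂ}

variable (V M K μ) in
/-- Reduced words in basis vectors of total degree `n`, applied to a basis of `M_μ`. -/
def reducedBasisWord (n : ℕ)
    (p : ColoredStrictPartition (BasisIndex V K) n × Fin (Module.finrank ℂ (weightSpace V M μ))) :
    weightSpace V M (μ + n) :=
  ⟨Word.op M (Word.ofBasis p.1.1) (Module.finBasis ℂ (weightSpace V M μ) p.2 : M), by
    have := Word.op_mem_weightSpace (l := Word.ofBasis p.1.1)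
      (Module.finBasis ℂ (weightSpace V M μ) p.2).2
    rwa [Word.degree_ofBasis, p.1.2.2, Int.cast_natCast] at this⟩

theorem span_reducedBasisWord {n : ℕ}
    (h : weightSpace V M (μ + n) = Word.reducedSpan V (weightSpace V M μ) K n) :
    Submodule.span ℂ (Set.range (reducedBasisWord V M K μ n)) = ⊤ := by
  have hbasis : weightSpace V M μ = Submodule.span ℂ
      (Set.range fun j => (Module.finBasis ℂ (weightSpace V M μ) j : M)) := by
    have := congrArg (Submodule.map (weightSpace V M μ).subtype)
      (Module.finBasis ℂ (weightSpace V M μ)).span_eq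
    rw [Submodule.map_span, ← Set.range_comp, Submodule.map_subtype_top] at this
    exact this.symm
  refine Submodule.map_injective_of_injective (Submodule.injective_subtype _) ?_
  rw [Submodule.map_subtype_top]
  refine le_antisymm (Submodule.map_subtype_le _ _) (h.le.trans (Submodule.span_le.mpr ?_))
  rintro _ ⟨l, w, hw, ⟨hl, hdecr⟩, hdeg, rfl⟩
  refine Submodule.span_le.mpr ?_ (Word.op_mem_span_ofBasis (K := K) hl (hbasis ▸ hw))
  rintro _ ⟨l', j, hl', rfl⟩
  have hmap : (l'.map Prod.snd).map (Nat.cast : ℕ → ℤ) = l.map Prod.snd := by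
    rw [← hl', List.map_map, Function.comp_def]
  have hdecr' : (l'.map Prod.snd).Pairwise (· > ·) := by
    have : ((l'.map Prod.snd).map (Nat.cast : ℕ → ℤ)).Pairwise (· > ·) :=
      hmap ▸ List.pairwise_map.mpr hdecr
    exact (List.pairwise_map.mp this).imp Nat.cast_lt.mp
  have hsum : (l'.map Prod.snd).sum = n := by
    rw [Word.degree, ← hmap, ← Nat.cast_list_sum] at hdeg
    exact_mod_cast hdeg
  exact ⟨_, Submodule.subset_span ⟨(⟨l', hdecr', hsum⟩, j), rfl⟩, rfl⟩

theorem finrank_weightSpace_le {n : ℕ}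
    (h : weightSpace V M (μ + n) = Word.reducedSpan V (weightSpace V M μ) K n) :
    Module.finrank ℂ (weightSpace V M (μ + n)) ≤
      Nat.card (ColoredStrictPartition (BasisIndex V K) n) *
        Module.finrank ℂ (weightSpace V M μ) := by
  have := Fintype.ofFinite (ColoredStrictPartition (BasisIndex V K) n)
  have hcard := finrank_range_le_card (R := ℂ) (reducedBasisWord V M K μ n)
  rwa [Set.finrank, span_reducedBasisWord h, finrank_top, Fintype.card_prod, Fintype.card_fin,
    ← Nat.card_eq_fintype_card] at hcard

/-! ### Zero modes -/

variable (M) in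
/-- The zero mode on `M_μ`, as a linear map in the vector of weight one. -/
def zeroModeHom (μ : ℂ) : WeightOne V →ₗ[ℂ] Module.End ℂ (weightSpace V M μ) where
  toFun a := zeroMode M a μ
  map_add' a b := by ext; simp [zeroMode, mode_add]
  map_smul' r a := by ext; simp [zeroMode, mode_smul]

variable (M K μ) in
/-- `C` bounds the zero mode of `a` on `V_0, …, V_K` and on `M_μ`. -/
structure ZeroModeBound (a : WeightOne V) (C : ℝ) : Prop where
  algebra : ∀ k ≤ K, DualBound (Module.finBasis ℂ (weightSpace V V ((k : ℤ) : ℂ)))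
    (zeroMode V a ((k : ℤ) : ℂ)) C
  module : DualBound (Module.finBasis ℂ (weightSpace V M μ)) (zeroMode M a μ) C

namespace ZeroModeBound

variable (M K μ) in
theorem exists_forall_linearMap {F : Type*} [NormedAddCommGroup F] [NormedSpace ℂ F]
    [FiniteDimensional ℂ F] (g : F →ₗ[ℂ] WeightOne V) :
    ∃ C : ℝ, 0 ≤ C ∧ ∀ v, ZeroModeBound M K μ (g v) (C * ‖v‖) := by
  choose R hR0 hR using fun k : ℕ => DualBound.exists_forall_linearMap
    (Module.finBasis ℂ (weightSpace V V ((k : ℤ) : ℂ))) (zeroModeHom V ((k : ℤ) : ℂ) ∘ₗ g)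
  obtain ⟨S, hS0, hS⟩ := DualBound.exists_forall_linearMap
    (Module.finBasis ℂ (weightSpace V M μ)) (zeroModeHom M μ ∘ₗ g)
  have hsum : 0 ≤ ∑ k ∈ Finset.range (K + 1), R k := Finset.sum_nonneg fun k _ => hR0 k
  refine ⟨∑ k ∈ Finset.range (K + 1), R k + S, by positivity, fun v =>
    ⟨fun k hk => (hR k v).mono ?_, (hS v).mono ?_⟩⟩
  · have := Finset.single_le_sum (f := R) (fun k _ => hR0 k) (Finset.mem_range_succ_iff.mpr hk)
    gcongr
    linarith
  · gcongr
    linarith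

variable {a : WeightOne V} {C : ℝ}

/-- The zero mode acts on words as a derivation, so each letter contributes at most `C`. -/
theorem norm_apply_mode_ofBasis_le (hC : ZeroModeBound M K μ a C) (l : List (BasisIndex V K × ℕ))
    (φ : Module.Dual ℂ M) {B : ℝ}
    (hB : ∀ (l' : List (BasisIndex V K × ℕ)) j, l'.map Prod.snd = l.map Prod.snd →
      ‖φ (Word.op M (Word.ofBasis l') (Module.finBasis ℂ (weightSpace V M μ) j : M))‖ ≤ B)
    (j : Fin (Module.finrank ℂ (weightSpace V M μ))) :
    ‖φ (mode M (a : V) 0 (Word.op M (Word.ofBasis l)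
      (Module.finBasis ℂ (weightSpace V M μ) j : M)))‖ ≤ (l.length + 1) * C * B := by
  induction l generalizing φ with
  | nil =>
    have := hC.module (φ ∘ₗ (weightSpace V M μ).subtype) B (fun j => hB [] j rfl) j
    simpa [Word.ofBasis, zeroMode] using this
  | cons p l ih =>
    have htail := ih (φ ∘ₗ (basisVector p.1).op M p.2) fun l' j hl' => by
      rw [LinearMap.comp_apply, ← Word.op_ofBasis_cons]
      exact hB (p :: l') j (by simp [hl'])
    have hhead := hC.algebra p.1.1 (by omega)
      (φ ∘ₗ modeApply M ((basisVector p.1).wt - 1 - p.2)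
        (Word.op M (Word.ofBasis l) (Module.finBasis ℂ (weightSpace V M μ) j : M)) ∘ₗ
        (homogeneous V (p.1.1 : ℕ)).subtype) B (fun i => by
      have := hB ((⟨p.1.1, i⟩, p.2) :: l) j (by simp)
      rwa [Word.op_ofBasis_cons] at this) p.1.2
    rw [Word.op_ofBasis_cons, HomogeneousVector.mode_zero_op, map_add, List.length_cons,
      Nat.cast_succ]
    refine (norm_add_le_of_le htail hhead).trans_eq ?_
    ring

theorem dualBound_reducedBasisWord (hC : ZeroModeBound M K μ a C) (hC0 : 0 ≤ C) (n : ℕ) :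
    DualBound (reducedBasisWord V M K μ n) (zeroMode M a (μ + n)) ((√(2 * n) + 2) * C) := by
  intro φ B hB p
  obtain ⟨ψ, rfl⟩ := LinearMap.exists_extend φ
  have hB0 : 0 ≤ B := (norm_nonneg _).trans (hB p)
  calc ‖ψ (mode M (a : V) 0 (reducedBasisWord V M K μ n p))‖
      ≤ (p.1.1.length + 1) * C * B :=
        hC.norm_apply_mode_ofBasis_le p.1.1 ψ (fun l' j hl' =>
          hB (⟨l', hl' ▸ p.1.2.1, hl' ▸ p.1.2.2⟩, j)) p.2
    _ ≤ (√(2 * n) + 2) * C * B := by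
        have hlen : (p.1.1.length : ℝ) + 1 ≤ √(2 * n) + 2 := by linarith [p.1.length_le]
        gcongr

end ZeroModeBound

end Reduced

/-! ### Convergence of characters -/

section Character

variable [IsOrdinaryModule V M] {K : ℕ} {μ : ℂ}

variable (M) in
/-- The coefficient `Tr_{M_μ} e^{2πi o(a)}` of the character. -/
def expTrace (a : WeightOne V) (μ : ℂ) : ℂ :=
  LinearMap.trace ℂ (weightSpace V M μ) (expEnd ((2 * Real.pi * Complex.I : ℂ) • zeroMode M a μ))

theorem expTrace_eq_zero {ν : ℂ} (h : weightSpace V M ν = ⊥) (a : WeightOne V) :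
    expTrace M a ν = 0 := by
  have := (Submodule.subsingleton_iff_eq_bot).mpr h
  rw [expTrace, Subsingleton.elim (expEnd _) 0, map_zero]

theorem differentiable_expTrace {F : Type*} [NormedAddCommGroup F] [NormedSpace ℂ F]
    [FiniteDimensional ℂ F] (g : F →ₗ[ℂ] WeightOne V) (ν : ℂ) :
    Differentiable ℂ fun v => expTrace M (g v) ν :=
  differentiable_trace_expEnd ((2 * Real.pi * Complex.I : ℂ) • zeroModeHom M ν ∘ₗ g)

theorem ZeroModeBound.norm_expTrace_le {a : WeightOne V} {C : ℝ} (hC : ZeroModeBound M K μ a C)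
    (hC0 : 0 ≤ C) {n : ℕ}
    (h : weightSpace V M (μ + n) = Word.reducedSpan V (weightSpace V M μ) K n) :
    ‖expTrace M a (μ + n)‖ ≤ Nat.card (ColoredStrictPartition (BasisIndex V K) n) *
      Module.finrank ℂ (weightSpace V M μ) * Real.exp (2 * Real.pi * C * (√(2 * n) + 2)) := by
  have hbound := (hC.dualBound_reducedBasisWord hC0 n).smul (2 * Real.pi * Complex.I)
  have hnorm : ‖(2 * Real.pi * Complex.I : ℂ)‖ = 2 * Real.pi := by simp [abs_of_pos Real.pi_pos]
  rw [hnorm, mul_comm _ C, ← mul_assoc] at hbound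
  refine (hbound.norm_trace_expEnd_le (span_reducedBasisWord h) (by positivity)).trans ?_
  gcongr
  exact_mod_cast finrank_weightSpace_le h

theorem exists_isSubexponential_forall_norm_expTrace_le
    (h : ∀ n : ℕ, weightSpace V M (μ + n) = Word.reducedSpan V (weightSpace V M μ) K n)
    {F : Type*} [NormedAddCommGroup F] [NormedSpace ℂ F] [FiniteDimensional ℂ F]
    (g : F →ₗ[ℂ] WeightOne V) (r : ℝ) :
    ∃ u, IsSubexponential u ∧ ∀ (n : ℕ) v, ‖v‖ ≤ r → ‖expTrace M (g v) (μ + n)‖ ≤ u n := by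
  obtain ⟨C, hC0, hC⟩ := ZeroModeBound.exists_forall_linearMap M K μ g
  refine ⟨_, ((IsSubexponential.card_coloredStrictPartition (BasisIndex V K)).mul
    (.const (Nat.cast_nonneg (Module.finrank ℂ (weightSpace V M μ))))).mul
      (.exp_mul_sqrt_add (2 * Real.pi * (C * r)) 2), fun n v hv => ?_⟩
  refine ((hC v).norm_expTrace_le (by positivity) (h n)).trans ?_
  gcongr

theorem characterTerm_add_natCast (a : WeightOne V) (τ : ℂ) (n : ℕ) :
    characterTerm M a τ (μ + n) =
      Complex.exp (2 * Real.pi * Complex.I * τ * (μ - centralCharge V / 24)) *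
        (expTrace M a (μ + n) * Complex.exp (2 * Real.pi * Complex.I * τ * n)) := by
  rw [characterTerm, expTrace, mul_left_comm, ← Complex.exp_add]
  ring_nf

theorem add_natCast_injective (μ : ℂ) : Function.Injective fun n : ℕ => μ + n :=
  (add_right_injective μ).comp Nat.cast_injective

variable (h₀ : ∀ ν, (∀ n : ℕ, μ + n ≠ ν) → weightSpace V M ν = ⊥)
include h₀

theorem characterTerm_eq_zero_of_notMem_range (a : WeightOne V) (τ : ℂ) {ν : ℂ}
    (hν : ν ∉ Set.range fun n : ℕ => μ + n) : characterTerm M a τ ν = 0 := by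
  have := expTrace_eq_zero (h₀ ν fun n hn => hν ⟨n, hn⟩) a
  rw [characterTerm, ← expTrace, this, zero_mul]

theorem character_eq_mul_tsum (a : WeightOne V) (τ : ℂ) :
    character M a τ = Complex.exp (2 * Real.pi * Complex.I * τ * (μ - centralCharge V / 24)) *
      ∑' n : ℕ, expTrace M a (μ + n) * Complex.exp (2 * Real.pi * Complex.I * τ * n) := by
  have hsupp : Function.support (characterTerm M a τ) ⊆ Set.range fun n : ℕ => μ + n :=
    Function.support_subset_iff'.mpr fun ν hν => characterTerm_eq_zero_of_notMem_range h₀ a τ hν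
  rw [character, ← tsum_mul_left, ← (add_natCast_injective μ).tsum_eq hsupp]
  exact tsum_congr (characterTerm_add_natCast a τ)

variable (h : ∀ n : ℕ, weightSpace V M (μ + n) = Word.reducedSpan V (weightSpace V M μ) K n)
include h

theorem summable_characterTerm (a : WeightOne V) {τ : ℂ} (hτ : 0 < τ.im) :
    Summable (characterTerm M a τ) := by
  obtain ⟨u, hu, hbound⟩ := exists_isSubexponential_forall_norm_expTrace_le h
    (LinearMap.toSpanSingleton ℂ _ a) 1
  have hcoeff (n : ℕ) : ‖expTrace M a (μ + n)‖ ≤ u n := by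
    simpa using hbound n 1 norm_one.le
  rw [← (add_natCast_injective μ).summable_iff fun ν hν =>
    characterTerm_eq_zero_of_notMem_range h₀ a τ hν]
  exact ((summable_mul_exp_of_isSubexponential hu hcoeff hτ).mul_left _).congr fun n =>
    (characterTerm_add_natCast a τ n).symm

theorem differentiableOn_character {F : Type*} [NormedAddCommGroup F] [NormedSpace ℂ F]
    [FiniteDimensional ℂ F] (g : F →ₗ[ℂ] WeightOne V) :
    DifferentiableOn ℂ (fun p : F × ℂ => character M (g p.1) p.2) {p | 0 < p.2.im} := by
  simp only [character_eq_mul_tsum h₀]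
  exact DifferentiableOn.mul (by fun_prop) <| differentiableOn_tsum_mul_exp
    (fun n => differentiable_expTrace g _) (exists_isSubexponential_forall_norm_expTrace_le h g)

end Character

end VOA

theorem HolomorphicOnProdUpperHalfPlane.comp_linearMap {E : Type u} [AddCommGroup E]
    [Module ℂ E] {F : Type v} [AddCommGroup F] [Module ℂ F] [Module.Finite ℂ F] {f : E → ℂ → ℂ}
    (hf : HolomorphicOnProdUpperHalfPlane f) (g : F →ₗ[ℂ] E) :
    HolomorphicOnProdUpperHalfPlane fun x τ => f (g x) τ := by
  refine ⟨inferInstance, fun r b => ?_⟩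
  have := hf.1
  let e := Module.finBasis ℂ E
  let G : (Fin r → ℂ) →L[ℂ] (Fin (Module.finrank ℂ E) → ℂ) :=
    (e.equivFun.toLinearMap ∘ₗ g ∘ₗ Fintype.linearCombination ℂ b).toContinuousLinearMap
  have hG (x : Fin r → ℂ) : ∑ i, G x i • e i = g (∑ i, x i • b i) :=
    e.sum_equivFun (g (∑ i, x i • b i))
  have hdiff : Differentiable ℂ fun p : (Fin r → ℂ) × ℂ => (G p.1, p.2) := by fun_prop
  exact ((hf.2 _ e).comp hdiff.differentiableOn fun p hp => hp).congr fun p _ => by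
    simp only [Function.comp_apply, hG]

end

theorem proposition1p1_general {V : Type*} [AddCommGroup V] [Module ℂ V]
    [VertexOperatorAlgebra V] [VOA.IsCFTType V] [Module.Finite ℂ (V ⧸ VOA.C₂ V)]
    {M : Type*} [AddCommGroup M] [Module ℂ M] [VOAModule V M] [VOA.IsOrdinaryModule V M]
    (hM : VOA.IsIrreducibleModule V M) :
    (∀ (a : VOA.WeightOne V) (τ : ℂ), 0 < τ.im → Summable (VOA.characterTerm M a τ)) ∧
    HolomorphicOnProdUpperHalfPlane
      (fun (a : VOA.WeightOne V) (τ : ℂ) => VOA.character M a τ) := by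
  obtain ⟨K, μ, h, h₀⟩ := VOA.Word.exists_weightSpace_eq_reducedSpan hM
  exact ⟨fun a τ hτ => VOA.summable_characterTerm h₀ h a hτ, inferInstance,
    fun r b => VOA.differentiableOn_character h₀ h (Fintype.linearCombination ℂ b)⟩

theorem proposition1p1 {V : Type*} [AddCommGroup V] [Module ℂ V] [VertexOperatorAlgebra V]
    [VOA.IsStronglyRational V] {M : Type*} [AddCommGroup M] [Module ℂ M] [VOAModule V M]
    [VOA.IsOrdinaryModule V M] (hM : VOA.IsIrreducibleModule V M)
    (𝔥 : LieSubalgebra ℂ (VOA.WeightOne V)) (h𝔥 : 𝔥.IsCartanSubalgebra) :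
    (∀ (x : 𝔥) (τ : ℂ), 0 < τ.im → Summable (VOA.characterTerm M (x : VOA.WeightOne V) τ)) ∧
    HolomorphicOnProdUpperHalfPlane
      (fun (x : 𝔥) (τ : ℂ) => VOA.character M (x : VOA.WeightOne V) τ) := by
  have : Module.Finite ℂ (V ⧸ VOA.C₂ V) := VOA.IsStronglyRational.C₂_cofinite
  have ⟨hsummable, hhol⟩ := proposition1p1_general hM
  exact ⟨fun x => hsummable x, hhol.comp_linearMap 𝔥.incl.toLinearMap⟩
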